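/- Consider the word RAM with words of $w$ bits (arithmetic: addition, subtraction, comparison; every instruction takes one time step). The input is a finite unweighted directed graph $G$ on $n$ numbered vertices, given by read-only adjacency lists in arbitrary order, with constant-time access to the number of vertices, to the degree of a vertex and to the entries of its list; an undirected graph is treated as a symmetric directed graph. Memory is reserved in blocks in constant time and is not initialized by this. It is either ordinary memory, in which a cell may be read only after it has been written, or lazy-initialized memory, in which a cell may be read before it has been written and then holds an arbitrary word. The space used by a run is the total number of memory words that it reserves (besides a constant number of registers). Let $\Delta$ be the maximum out-degree of $G$, and let $d(s,t)\in\mathbb{N}\cup\{\infty\}$ be the minimum number of directed edges on a path from $s$ to $t$ ($\infty$ if $t$ is not reachable from $s$). *Sorted-APSD enumeration* is the task to emit, for all ordered pairs $(s,t)$ of vertices (including $s=t$), the triple $(s,t,d(s,t))$ exactly once, and nothing else, in weakly increasing order of $d(s,t)$ (infinite distances last). An algorithm solves it *with delay at most $D$* (without preprocessing) if at most $D$ time steps pass from the start to the first output, between any two consecutive outputs, and from the last output (from the start, if there is none) to the end of the computation. **Theorem.** Unweighted sorted-APSD enumeration can be solved with delay in $O(\max(1,\Delta))$, with $\Theta(n^2)$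 lazy-initialized memory and with space complexity in $\Theta(n^2)$, on a word RAM with word size in $\Omega(\log n)$ that suffices to address this memory. That is, there are a fixed program and a positive integer constant $C$ such that for every such graph $G$, every adjacency list representation of it, every word size $w$ with $2^w\ge C(n+1)^2$ and every initial content of the lazy-initialized memory, the program emits all triples $(s,t,d(s,t))$ in sorted order with delay at most $C\cdot\max(1,\Delta)$ and halts, and the number of reserved words of lazy-initialized memory as well as the total number of reserved memory words lie between $n^2/C$ and $C n^2$. -/

import Mathlib

/-! ### Graphs -/

/-- `IsWalk G k s t`: there is a directed walk with exactly `k` edge hops from `s` to `t`. -/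
inductive IsWalk {V : Type} (G : Digraph V) : ℕ → V → V → Prop
  | nil (s : V) : IsWalk G 0 s s
  | cons {k : ℕ} {s u t : V} : G.Adj s u → IsWalk G k u t → IsWalk G (k + 1) s t

/-- The distance `d(s, t)`: the minimum number of directed edge hops needed to reach `t` from `s`,
and `⊤` if `t` is not reachable from `s`. -/
noncomputable def hopDist {V : Type} (G : Digraph V) (s t : V) : ℕ∞ :=
  ⨅ (k : ℕ) (_ : IsWalk G k s t), (k : ℕ∞)

/-- The maximum (out-)degree `Δ`, with value `0` for the graph without vertices. -/
noncomputable def maxDeg {n : ℕ} (G : Digraph (Fin n)) : ℕ :=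
  Finset.univ.sup fun v : Fin n => Set.ncard {u | G.Adj v u}

/-- `nbrs` is an adjacency list representation of `G`: for each vertex the list of its
out-neighbours, each listed once, in an arbitrary order. An undirected graph is a symmetric `G`, so
that each of its edges is in the list of both its end points. -/
def IsAdjList {n : ℕ} (G : Digraph (Fin n)) (nbrs : Fin n → List (Fin n)) : Prop :=
  ∀ v, (nbrs v).Nodup ∧ ∀ u, u ∈ nbrs v ↔ G.Adj v u

/-! ### The word RAM

Words are the numbers below `2 ^ w`. A machine has finitely many registers holding one word each, a
read-only input graph on `{0, …, n - 1}`, and two word-addressed memory segments, in both of which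
space has to be reserved before it is used; reserving takes one step and does not initialize
anything. A cell of the ordinary segment may be read only after it has been written. A cell of the
lazy segment may be read at any time, but until it is first written it holds an arbitrary word. Every
instruction takes one step. An illegal instruction (an access outside the reserved area, a read of an
unwritten cell of the ordinary segment, a query for a vertex or a list entry that does not exist, a
reservation beyond the `2 ^ w` addressable cells) crashes the machine. -/

/-- The instructions of a program with labels `L` and registers `R`. The last argument(s) of type `L`
name the instruction to go on with; a register `d` is a destination. -/
inductive Instr (L R : Type)
  /-- `d := k` -/
  | const (d : R) (k : ℕ) (next : L)
  /-- `d := a` -/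
  | move (d a : R) (next : L)
  /-- `d := a + b`, modulo `2 ^ w` -/
  | add (d a b : R) (next : L)
  /-- `d := a - b`, with value `0` if `a < b` -/
  | sub (d a b : R) (next : L)
  /-- go to `yes` if `a < b`, and to `no` otherwise -/
  | ifLt (a b : R) (yes no : L)
  /-- go to `yes` if `a = b`, and to `no` otherwise -/
  | ifEq (a b : R) (yes no : L)
  /-- `d :=` the number of vertices -/
  | numVerts (d : R) (next : L)
  /-- `d :=` the degree of the vertex `v` -/
  | degree (d v : R) (next : L)
  /-- `d :=` entry number `i` of the adjacency list of the vertex `v`, counted from `0` -/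
  | neighbor (d v i : R) (next : L)
  /-- reserve `size` more cells of the ordinary segment, `d :=` address of the first of them -/
  | reserve (d size : R) (next : L)
  /-- `d :=` content of the ordinary cell with address `a` -/
  | load (d a : R) (next : L)
  /-- content of the ordinary cell with address `a` `:= b` -/
  | store (a b : R) (next : L)
  /-- reserve `size` more cells of the lazy segment, `d :=` address of the first of them -/
  | lazyReserve (d size : R) (next : L)
  /-- `d :=` content of the lazy cell with address `a` -/
  | lazyLoad (d a : R) (next : L)
  /-- content of the lazy cell with address `a` `:= b` -/
  | lazyStore (a b : R) (next : L)
  /-- emit the triple `(s, t, x)` -/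
  | emit (s t x : R) (next : L)
  /-- emit the triple `(s, t, ∞)` -/
  | emitInf (s t : R) (next : L)
  /-- the computation is finished -/
  | halt

/-- A program: finitely many labelled instructions over finitely many registers. It is fixed once
and for all, independently of the input and of the word size. -/
structure Program where
  L : Type
  R : Type
  finL : Finite L
  finR : Finite R
  decR : DecidableEq R
  start : L
  code : L → Instr L R

attribute [instance] Program.finL Program.finR Program.decR

/-- A distance triple `(s, t, d)`. -/
abbrev Triple : Type := ℕ × ℕ × ℕ∞

/-- A configuration of the machine; `mem a = none` means that the ordinary cell `a` has not been
written. The two sizes are the numbers of cells reserved so far. -/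
structure Config (P : Program) where
  pc : P.L
  reg : P.R → ℕ
  mem : ℕ → Option ℕ
  memSize : ℕ
  lazy : ℕ → ℕ
  lazySize : ℕ

namespace Config

variable {P : Program}

/-- Go on with instruction `l`. -/
def goto (c : Config P) (l : P.L) : Config P := { c with pc := l }

/-- Assign `x`, reduced to a word, to the register `d` and go on with instruction `l`. -/
def assign (w : ℕ) (c : Config P) (d : P.R) (x : ℕ) (l : P.L) : Config P :=
  { c with reg := Function.update c.reg d (x % 2 ^ w), pc := l }

/-- The initial configuration: all registers are `0`, no memory is reserved, and the lazy segment
holds the words `junk`. -/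
def init (P : Program) {w : ℕ} (junk : ℕ → Fin (2 ^ w)) : Config P where
  pc := P.start
  reg := fun _ => 0
  mem := fun _ => none
  memSize := 0
  lazy := fun a => (junk a : ℕ)
  lazySize := 0

/-- The computation is finished. -/
def Halted (c : Config P) : Prop := P.code c.pc = Instr.halt

/-- The total number of reserved memory words (the registers, whose number depends only on the
program, are not counted). Memory is never released. -/
def space (c : Config P) : ℕ := c.memSize + c.lazySize

end Config

/-- One step with word size `w` on the input graph with adjacency lists `nbrs`: the next
configuration together with the triple that is emitted in this step, if any. The value is `none` if
the machine has halted or crashes. -/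
def step (P : Program) (w : ℕ) {n : ℕ} (nbrs : Fin n → List (Fin n)) (c : Config P) :
    Option (Config P × Option Triple) :=
  match P.code c.pc with
  | .const d k l => some (c.assign w d k l, none)
  | .move d a l => some (c.assign w d (c.reg a) l, none)
  | .add d a b l => some (c.assign w d (c.reg a + c.reg b) l, none)
  | .sub d a b l => some (c.assign w d (c.reg a - c.reg b) l, none)
  | .ifLt a b y l => some (c.goto (if c.reg a < c.reg b then y else l), none)
  | .ifEq a b y l => some (c.goto (if c.reg a = c.reg b then y else l), none)
  | .numVerts d l => some (c.assign w d n l, none)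
  | .degree d v l =>
      if h : c.reg v < n then some (c.assign w d (nbrs ⟨c.reg v, h⟩).length l, none) else none
  | .neighbor d v i l =>
      if h : c.reg v < n then
        match (nbrs ⟨c.reg v, h⟩)[c.reg i]? with
        | some u => some (c.assign w d u l, none)
        | none => none
      else none
  | .reserve d size l =>
      if c.memSize + c.reg size ≤ 2 ^ w then
        some ({ c with memSize := c.memSize + c.reg size }.assign w d c.memSize l, none)
      else none
  | .load d a l =>
      if c.reg a < c.memSize then
        match c.mem (c.reg a) with
        | some x => some (c.assign w d x l, none)
        | none => none
      else none
  | .store a b l =>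
      if c.reg a < c.memSize then
        some ({ c with mem := Function.update c.mem (c.reg a) (some (c.reg b)) }.goto l, none)
      else none
  | .lazyReserve d size l =>
      if c.lazySize + c.reg size ≤ 2 ^ w then
        some ({ c with lazySize := c.lazySize + c.reg size }.assign w d c.lazySize l, none)
      else none
  | .lazyLoad d a l =>
      if c.reg a < c.lazySize then some (c.assign w d (c.lazy (c.reg a)) l, none) else none
  | .lazyStore a b l =>
      if c.reg a < c.lazySize then
        some ({ c with lazy := Function.update c.lazy (c.reg a) (c.reg b) }.goto l, none)
      else none
  | .emit s t x l => some (c.goto l, some (c.reg s, c.reg t, (c.reg x : ℕ∞)))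
  | .emitInf s t l => some (c.goto l, some (c.reg s, c.reg t, ⊤))
  | .halt => none

/-- `SilentSteps P w nbrs k c c'`: from `c` the machine gets to `c'` in exactly `k` steps, none of
which emits anything. -/
inductive SilentSteps (P : Program) (w : ℕ) {n : ℕ} (nbrs : Fin n → List (Fin n)) :
    ℕ → Config P → Config P → Prop
  | refl (c : Config P) : SilentSteps P w nbrs 0 c c
  | head {k : ℕ} {c c' c'' : Config P} : step P w nbrs c = some (c', none) →
      SilentSteps P w nbrs k c' c'' → SilentSteps P w nbrs (k + 1) c c''

/-- `Enumerates P w nbrs D c out cf`: from `c` the machine emits exactly the triples of the list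
`out`, in this order, and then halts in `cf`; the first output, each further output and finally the
end of the computation come at most `D` steps after the start or the preceding output. So
`Enumerates` from the initial configuration is enumeration with delay at most `D` without any
preprocessing. -/
inductive Enumerates (P : Program) (w : ℕ) {n : ℕ} (nbrs : Fin n → List (Fin n)) (D : ℕ) :
    Config P → List Triple → Config P → Prop
  | finish {k : ℕ} {c cf : Config P} : SilentSteps P w nbrs k c cf → k ≤ D → cf.Halted →
      Enumerates P w nbrs D c [] cf
  | output {k : ℕ} {c c' c'' cf : Config P} {o : Triple} {out : List Triple} :
      SilentSteps P w nbrs k c c' → step P w nbrs c' = some (c'', some o) → k + 1 ≤ D →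
      Enumerates P w nbrs D c'' out cf → Enumerates P w nbrs D c (o :: out) cf

/-- `out` is a solution of sorted all pairs shortest distance enumeration on `G`: each triple
`(s, t, d(s, t))` occurs exactly once, nothing else occurs, and the distances are weakly increasing
along the list (so that the infinite ones come last). -/
def IsSortedAPSD {n : ℕ} (G : Digraph (Fin n)) (out : List Triple) : Prop :=
  out.Nodup ∧
  (∀ o : Triple, o ∈ out ↔ ∃ s t : Fin n, o = ((s : ℕ), (t : ℕ), hopDist G s t)) ∧
  out.Pairwise fun o o' => o.2.2 ≤ o'.2.2

/-! A breadth-first search runs from all sources at once, with one queue of records of pairs `(s,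
t)` and their labels. The records of the pairs `(s, s)` are created and emitted before anything is
taken from the queue, each followed by a scan of its adjacency list. Labels increase weakly along
the queue, so emission in queue order is sorted, and at most one adjacency list is scanned between
two outputs; hence the delay.

A pair has the key `s * n + t + 1`. Initializing a table of `n²` keys would ruin the delay. Instead
the lazy cell of a key proposes a record number, which counts only if that record is in use and
stores the same key, so that arbitrary initial words do no harm (`Run.test`). As there is no
multiplication, memory is reserved row by row, as the pairs `(s, s)` are created, and key offsets
arise by adding `n`.

The infinite distances belong to the keys never recorded. Passing long runs of known keys one by one
would again ruin the delay, so the two ends of each maximal interval of known keys point at each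
other. A new key joins at most two intervals and changes only the pointers at the outer ends
(`Table.Stored.insert`, `Run.mark`). In the final sweep a known interval is jumped over in constant
time, and the key after it is unknown (`Run.rest`).

Labels are exact at the end: each record comes with a walk of that length, and closedness of all
records under edges, starting from the pairs `(s, s)`, shows that no walk is shorter
(`Table.Queue.hopDist_eq`). -/

set_option linter.constructorNameAsVariable false

/-! ### The program -/

namespace APSD

/-- The registers. -/
inductive Reg
  | n | one | zero | n8 | dc | tl | hd | s | t | u | d1 | base | nb | deg | i | k | q | j | a | x
  | p | lp | rp | idx
  deriving DecidableEq

instance : Fintype Reg where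
  elems := {.n, .one, .zero, .n8, .dc, .tl, .hd, .s, .t, .u, .d1, .base, .nb, .deg, .i, .k, .q, .j,
    .a, .x, .p, .lp, .rp, .idx}
  complete x := by cases x <;> decide

/-- The places in the program where it is tested whether a pair is known. -/
inductive Site
  | scan | left | right | rest
  deriving DecidableEq

instance : Fintype Site where
  elems := {.scan, .left, .right, .rest}
  complete x := by cases x <;> decide

/-- The labels: a block of instructions and a position in it. -/
inductive Lbl
  | init (i : Fin 12)
  | loop
  | diag (i : Fin 9)
  | pop (i : Fin 13)
  | out (i : Fin 5)
  | scan (i : Fin 6)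
  | test (b : Site) (i : Fin 9)
  | mark (i : Fin 28)
  | markedDiag
  | markedPush
  | rest (i : Fin 19)
  | fin
  deriving DecidableEq, Fintype

/-- Where to go on if the tested pair is known. -/
def yes : Site → Lbl
  | .scan => .scan 0
  | .left => .mark 6
  | .right => .mark 10
  | .rest => .rest 5

/-- Where to go on if the tested pair is not known. -/
def no : Site → Lbl
  | .scan => .scan 5
  | .left => .mark 9
  | .right => .mark 13
  | .rest => .rest 13

/-- Set up the constants and reserve the records of the pairs `(s, s)`. -/
def initCode : Fin 12 → Instr Lbl Reg
  | 0 => .numVerts .n (.init 1)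
  | 1 => .const .one 1 (.init 2)
  -- For `n = 0` nothing may be reserved, because the upper bound on the space is then `0`. The
  -- register `zero` is never assigned and keeps its initial value.
  | 2 => .ifEq .n .zero .fin (.init 3)
  -- Two extra lazy cells: the keys `0` and `n * n + 1` belong to no pair but are queried as
  -- neighbours of the extreme keys.
  | 3 => .const .x 2 (.init 4)
  | 4 => .lazyReserve .a .x (.init 5)
  -- A record takes eight cells, so that its address arises by three doublings. Cells 0 to 3 hold
  -- key, source, target and label, cells 4 and 5 the addresses of the left and the right end; the
  -- last two stay unused.
  | 5 => .add .x .n .n (.init 6)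
  | 6 => .add .x .x .x (.init 7)
  | 7 => .add .n8 .x .x (.init 8)
  | 8 => .reserve .a .n8 (.init 9)
  | 9 => .move .tl .n (.init 10)
  | 10 => .move .hd .n (.init 11)
  | 11 => .move .nb .one .loop

/-- Reserve the next row and turn to the next pair `(s, s)`. -/
def diagCode : Fin 9 → Instr Lbl Reg
  | 0 => .lazyReserve .a .n (.diag 1)
  | 1 => .reserve .a .n8 (.diag 2)
  -- `nb` is the first key of the next row; adding `n` for each row replaces a multiplication.
  | 2 => .move .base .nb (.diag 3)
  | 3 => .add .nb .nb .n (.diag 4)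
  | 4 => .move .s .dc (.diag 5)
  | 5 => .move .t .dc (.diag 6)
  | 6 => .move .d1 .zero (.diag 7)
  | 7 => .add .k .base .t (.diag 8)
  | 8 => .move .idx .dc (.mark 0)

/-- Take the next record from the queue. -/
def popCode : Fin 13 → Instr Lbl Reg
  | 0 => .ifEq .hd .tl (.rest 0) (.pop 1)
  | 1 => .add .a .hd .hd (.pop 2)
  | 2 => .add .a .a .a (.pop 3)
  | 3 => .add .a .a .a (.pop 4)
  | 4 => .load .k .a (.pop 5)
  | 5 => .add .a .a .one (.pop 6)
  | 6 => .load .s .a (.pop 7)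
  | 7 => .add .a .a .one (.pop 8)
  | 8 => .load .t .a (.pop 9)
  | 9 => .add .a .a .one (.pop 10)
  | 10 => .load .d1 .a (.pop 11)
  -- Key minus target is `s * n + 1`, again without multiplication.
  | 11 => .sub .base .k .t (.pop 12)
  | 12 => .add .hd .hd .one (.out 0)

/-- Emit a finite distance and prepare the scan of the adjacency list. -/
def outCode : Fin 5 → Instr Lbl Reg
  | 0 => .move .u .t (.out 1)
  | 1 => .emit .s .u .d1 (.out 2)
  | 2 => .add .d1 .d1 .one (.out 3)
  | 3 => .degree .deg .u (.out 4)
  | 4 => .const .i 0 (.scan 0)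

/-- Go through the adjacency list of `u` and mark the new pairs `(s, t)`. -/
def scanCode : Fin 6 → Instr Lbl Reg
  | 0 => .ifEq .i .deg .loop (.scan 1)
  | 1 => .neighbor .t .u .i (.scan 2)
  | 2 => .add .i .i .one (.scan 3)
  | 3 => .add .k .base .t (.scan 4)
  | 4 => .move .q .k (.test .scan 0)
  | 5 => .move .idx .tl (.mark 0)

/-- Test whether the pair with key `q` is known; if so, `a` is the address of its record. -/
def testCode (b : Site) : Fin 9 → Instr Lbl Reg
  | 0 => .lazyLoad .j .q (.test b 1)
  | 1 => .ifLt .j .dc (.test b 4) (.test b 2)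
  | 2 => .ifLt .j .n (no b) (.test b 3)
  | 3 => .ifLt .j .tl (.test b 4) (no b)
  | 4 => .add .a .j .j (.test b 5)
  | 5 => .add .a .a .a (.test b 6)
  | 6 => .add .a .a .a (.test b 7)
  | 7 => .load .x .a (.test b 8)
  | 8 => .ifEq .x .q (yes b) (no b)

/-- Write the record number `idx` for the pair `(s, t)` with key `k` and merge the adjacent intervals
of known keys. -/
def markCode : Fin 28 → Instr Lbl Reg
  | 0 => .add .p .idx .idx (.mark 1)
  | 1 => .add .p .p .p (.mark 2)
  | 2 => .add .p .p .p (.mark 3)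
  -- By default the new key is an interval of its own; a known neighbour replaces the respective
  -- end.
  | 3 => .move .lp .p (.mark 4)
  | 4 => .move .rp .p (.mark 5)
  | 5 => .sub .q .k .one (.test .left 0)
  | 6 => .const .x 4 (.mark 7)
  | 7 => .add .a .a .x (.mark 8)
  | 8 => .load .lp .a (.mark 9)
  | 9 => .add .q .k .one (.test .right 0)
  | 10 => .const .x 5 (.mark 11)
  | 11 => .add .a .a .x (.mark 12)
  | 12 => .load .rp .a (.mark 13)
  | 13 => .store .p .k (.mark 14)
  | 14 => .add .a .p .one (.mark 15)
  | 15 => .store .a .s (.mark 16)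
  | 16 => .add .a .a .one (.mark 17)
  | 17 => .store .a .t (.mark 18)
  | 18 => .add .a .a .one (.mark 19)
  | 19 => .store .a .d1 (.mark 20)
  | 20 => .lazyStore .k .idx (.mark 21)
  | 21 => .const .x 5 (.mark 22)
  | 22 => .add .a .lp .x (.mark 23)
  | 23 => .store .a .rp (.mark 24)
  | 24 => .const .x 4 (.mark 25)
  | 25 => .add .a .rp .x (.mark 26)
  | 26 => .store .a .lp (.mark 27)
  -- The record number tells which of the two callers to return to: numbers below `n` belong to
  -- pairs `(s, s)`.
  | _ => .ifLt .idx .n .markedDiag .markedPush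

/-- Emit the infinite distances, jumping over the intervals of known keys. -/
def restCode : Fin 19 → Instr Lbl Reg
  | 0 => .move .s .zero (.rest 1)
  | 1 => .move .t .zero (.rest 2)
  | 2 => .move .k .one (.rest 3)
  | 3 => .ifEq .s .n .fin (.rest 4)
  | 4 => .move .q .k (.test .rest 0)
  | 5 => .const .x 5 (.rest 6)
  | 6 => .add .a .a .x (.rest 7)
  -- `a` becomes the address of the record at the right end; reading the pair from there avoids a
  -- division of the key.
  | 7 => .load .a .a (.rest 8)
  | 8 => .load .k .a (.rest 9)
  | 9 => .add .a .a .one (.rest 10)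
  | 10 => .load .s .a (.rest 11)
  | 11 => .add .a .a .one (.rest 12)
  | 12 => .load .t .a (.rest 14)
  | 13 => .emitInf .s .t (.rest 14)
  | 14 => .add .k .k .one (.rest 15)
  | 15 => .add .t .t .one (.rest 16)
  | 16 => .ifEq .t .n (.rest 17) (.rest 3)
  | 17 => .move .t .zero (.rest 18)
  | _ => .add .s .s .one (.rest 3)

/-- The whole program. -/
def code : Lbl → Instr Lbl Reg
  | .init i => initCode i
  | .loop => .ifLt .dc .n (.diag 0) (.pop 0)
  | .diag i => diagCode i
  | .pop i => popCode i
  | .out i => outCode i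
  | .scan i => scanCode i
  | .test b i => testCode b i
  | .mark i => markCode i
  | .markedDiag => .add .dc .dc .one (.out 0)
  | .markedPush => .add .tl .tl .one (.scan 0)
  | .rest i => restCode i
  | .fin => .halt

/-- The program that solves sorted all pairs shortest distance enumeration. -/
def prog : Program where
  L := Lbl
  R := Reg
  finL := inferInstance
  finR := inferInstance
  decR := inferInstance
  start := .init 0
  code := code

/-! ### Running the program -/

/-- A configuration of the program. -/
def cfg (l : Lbl) (r : Reg → ℕ) (m : ℕ → Option ℕ) (ms : ℕ) (lz : ℕ → ℕ) (ls : ℕ) : Config prog :=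
  ⟨l, r, m, ms, lz, ls⟩

variable {w n : ℕ} {nbrs : Fin n → List (Fin n)} {D : ℕ} {good : List Triple → ℕ → ℕ → Prop}
  {k : ℕ} {pre : List Triple} {l l' : Lbl} {r : Reg → ℕ} {m : ℕ → Option ℕ} {ms : ℕ}
  {lz : ℕ → ℕ} {ls : ℕ}

/-- Given that `pre` has been emitted, the run from the given configuration emits the next triple or
halts within `k` steps, goes on with delay at most `D`, and altogether the emitted list and the final
sizes of the two memory segments are `good`. -/
def Run (w : ℕ) {n : ℕ} (nbrs : Fin n → List (Fin n)) (D : ℕ) (good : List Triple → ℕ → ℕ → Prop)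
    (k : ℕ) (pre : List Triple) (l : Lbl) (r : Reg → ℕ) (m : ℕ → Option ℕ) (ms : ℕ)
    (lz : ℕ → ℕ) (ls : ℕ) : Prop :=
  ∃ (c : Config prog) (j : ℕ), SilentSteps prog w nbrs j (cfg l r m ms lz ls) c ∧ j ≤ k ∧
    ((c.Halted ∧ good pre c.memSize c.lazySize) ∨
      ∃ (c' cf : Config prog) (o : Triple) (out : List Triple),
        step prog w nbrs c = some (c', some o) ∧ j + 1 ≤ k ∧
        Enumerates prog w nbrs D c' out cf ∧ good (pre ++ o :: out) cf.memSize cf.lazySize)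

theorem Run.enumerates (h : Run w nbrs D good D pre l r m ms lz ls) :
    ∃ (out : List Triple) (cf : Config prog),
      Enumerates prog w nbrs D (cfg l r m ms lz ls) out cf ∧
      good (pre ++ out) cf.memSize cf.lazySize := by
  obtain ⟨c, j, hs, hj, ⟨hh, hg⟩ | ⟨c', cf, o, out, hst, hj', he, hg⟩⟩ := h
  · exact ⟨[], c, .finish hs hj hh, by simpa using hg⟩
  · exact ⟨o :: out, cf, .output hs hst hj' he, hg⟩

theorem Run.mono {k' : ℕ} (hk : k ≤ k') (h : Run w nbrs D good k pre l r m ms lz ls) :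
    Run w nbrs D good k' pre l r m ms lz ls := by
  obtain ⟨c, j, hs, hj, h | ⟨c', cf, o, out, hst, hj', he, hg⟩⟩ := h
  · exact ⟨c, j, hs, hj.trans hk, .inl h⟩
  · exact ⟨c, j, hs, hj.trans hk, .inr ⟨c', cf, o, out, hst, hj'.trans hk, he, hg⟩⟩

theorem Run.of_step {r' : Reg → ℕ} {m' : ℕ → Option ℕ} {ms' : ℕ} {lz' : ℕ → ℕ} {ls' : ℕ}
    (hs : step prog w nbrs (cfg l r m ms lz ls) = some (cfg l' r' m' ms' lz' ls', none))
    (h : Run w nbrs D good k pre l' r' m' ms' lz' ls') :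
    Run w nbrs D good (k + 1) pre l r m ms lz ls := by
  obtain ⟨c, j, hs', hj, h | ⟨c', cf, o, out, hst, hj', he, hg⟩⟩ := h
  · exact ⟨c, j + 1, .head hs hs', by omega, .inl h⟩
  · exact ⟨c, j + 1, .head hs hs', by omega, .inr ⟨c', cf, o, out, hst, by omega, he, hg⟩⟩

/-- An output restarts the delay count, so the remaining run gets the fresh budget `D`. -/
theorem Run.of_emit {o : Triple} {r' : Reg → ℕ} {m' : ℕ → Option ℕ} {ms' : ℕ} {lz' : ℕ → ℕ}
    {ls' : ℕ}
    (hs : step prog w nbrs (cfg l r m ms lz ls) = some (cfg l' r' m' ms' lz' ls', some o))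
    (h : Run w nbrs D good D (pre ++ [o]) l' r' m' ms' lz' ls') :
    Run w nbrs D good (k + 1) pre l r m ms lz ls := by
  obtain ⟨out, cf, he, hg⟩ := h.enumerates
  exact ⟨_, 0, .refl _, by omega, .inr ⟨_, cf, o, out, hs, by omega, he, by simpa using hg⟩⟩

theorem Run.halt (hc : code l = .halt) (h : good pre ms ls) :
    Run w nbrs D good k pre l r m ms lz ls :=
  ⟨_, 0, .refl _, by omega, .inl ⟨hc, h⟩⟩

theorem prog_code {i : Instr Lbl Reg} (hc : code l = i) :
    prog.code l = i := hc

/-- The rules from here on execute the program symbolically, each at the cost of one unit of the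
budget. The bounds by `2 ^ w` make the reduction to words void. -/
theorem Run.const {d : Reg} {x : ℕ} (hc : code l = .const d x l') (hw : x < 2 ^ w)
    (h : Run w nbrs D good k pre l' (Function.update r d x) m ms lz ls) :
    Run w nbrs D good (k + 1) pre l r m ms lz ls := by
  refine .of_step ?_ h
  simp only [step, cfg, prog_code hc, Config.assign, Nat.mod_eq_of_lt hw]
  rfl

theorem Run.move {d a : Reg} (x : ℕ) (hc : code l = .move d a l') (hx : r a = x) (hw : x < 2 ^ w)
    (h : Run w nbrs D good k pre l' (Function.update r d x) m ms lz ls) :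
    Run w nbrs D good (k + 1) pre l r m ms lz ls := by
  subst hx
  refine .of_step ?_ h
  simp only [step, cfg, prog_code hc, Config.assign, Nat.mod_eq_of_lt hw]
  rfl

theorem Run.add {d a b : Reg} (x : ℕ) (hc : code l = .add d a b l') (hx : r a + r b = x)
    (hw : x < 2 ^ w)
    (h : Run w nbrs D good k pre l' (Function.update r d x) m ms lz ls) :
    Run w nbrs D good (k + 1) pre l r m ms lz ls := by
  subst hx
  refine .of_step ?_ h
  simp only [step, cfg, prog_code hc, Config.assign, Nat.mod_eq_of_lt hw]
  rfl

theorem Run.sub {d a b : Reg} (x : ℕ) (hc : code l = .sub d a b l') (hx : r a - r b = x)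
    (hw : x < 2 ^ w)
    (h : Run w nbrs D good k pre l' (Function.update r d x) m ms lz ls) :
    Run w nbrs D good (k + 1) pre l r m ms lz ls := by
  subst hx
  refine .of_step ?_ h
  simp only [step, cfg, prog_code hc, Config.assign, Nat.mod_eq_of_lt hw]
  rfl

theorem Run.ifLt {a b : Reg} {y z : Lbl} (hc : code l = .ifLt a b y z)
    (hy : r a < r b → Run w nbrs D good k pre y r m ms lz ls)
    (hz : r b ≤ r a → Run w nbrs D good k pre z r m ms lz ls) :
    Run w nbrs D good (k + 1) pre l r m ms lz ls := by
  by_cases h : r a < r b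
  · refine .of_step ?_ (hy h)
    simp only [step, cfg, prog_code hc, Config.goto]
    exact congrArg (fun l => some (cfg l r m ms lz ls, none)) (if_pos h)
  · refine .of_step ?_ (hz (not_lt.1 h))
    simp only [step, cfg, prog_code hc, Config.goto]
    exact congrArg (fun l => some (cfg l r m ms lz ls, none)) (if_neg h)

theorem Run.ifEq {a b : Reg} {y z : Lbl} (hc : code l = .ifEq a b y z)
    (hy : r a = r b → Run w nbrs D good k pre y r m ms lz ls)
    (hz : r a ≠ r b → Run w nbrs D good k pre z r m ms lz ls) :
    Run w nbrs D good (k + 1) pre l r m ms lz ls := by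
  by_cases h : r a = r b
  · refine .of_step ?_ (hy h)
    simp only [step, cfg, prog_code hc, Config.goto]
    exact congrArg (fun l => some (cfg l r m ms lz ls, none)) (if_pos h)
  · refine .of_step ?_ (hz h)
    simp only [step, cfg, prog_code hc, Config.goto]
    exact congrArg (fun l => some (cfg l r m ms lz ls, none)) (if_neg h)

theorem Run.numVerts {d : Reg} (hc : code l = .numVerts d l') (hw : n < 2 ^ w)
    (h : Run w nbrs D good k pre l' (Function.update r d n) m ms lz ls) :
    Run w nbrs D good (k + 1) pre l r m ms lz ls := by
  refine .of_step ?_ h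
  simp only [step, cfg, prog_code hc, Config.assign, Nat.mod_eq_of_lt hw]
  rfl

theorem Run.degree {d a : Reg} (v : Fin n) (hc : code l = .degree d a l') (hv : r a = v)
    (hw : (nbrs v).length < 2 ^ w)
    (h : Run w nbrs D good k pre l' (Function.update r d (nbrs v).length) m ms lz ls) :
    Run w nbrs D good (k + 1) pre l r m ms lz ls := by
  refine .of_step ?_ h
  have hlt : r a < n := hv ▸ v.2
  have e : (⟨r a, hlt⟩ : Fin n) = v := Fin.ext hv
  simp only [step, cfg, prog_code hc, Config.assign, hlt, e, Nat.mod_eq_of_lt hw, dite_true]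
  rfl

theorem Run.neighbor {d a b : Reg} (v u : Fin n) (hc : code l = .neighbor d a b l') (hv : r a = v)
    (hu : (nbrs v)[r b]? = some u) (hw : (u : ℕ) < 2 ^ w)
    (h : Run w nbrs D good k pre l' (Function.update r d u) m ms lz ls) :
    Run w nbrs D good (k + 1) pre l r m ms lz ls := by
  refine .of_step ?_ h
  have hlt : r a < n := hv ▸ v.2
  have e : (⟨r a, hlt⟩ : Fin n) = v := Fin.ext hv
  simp only [step, cfg, prog_code hc, Config.assign, hlt, e, hu, Nat.mod_eq_of_lt hw, dite_true]
  rfl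

theorem Run.reserve {d a : Reg} (x : ℕ) (hc : code l = .reserve d a l') (hx : r a = x)
    (hw : ms + x < 2 ^ w)
    (h : Run w nbrs D good k pre l' (Function.update r d ms) m (ms + x) lz ls) :
    Run w nbrs D good (k + 1) pre l r m ms lz ls := by
  subst hx
  refine .of_step ?_ h
  have h1 : ms < 2 ^ w := by omega
  simp only [step, cfg, prog_code hc, Config.assign, hw.le, if_true, Nat.mod_eq_of_lt h1]
  rfl

theorem Run.load {d a : Reg} (x : ℕ) (hc : code l = .load d a l') (ha : r a < ms)
    (hx : m (r a) = some x) (hw : x < 2 ^ w)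
    (h : Run w nbrs D good k pre l' (Function.update r d x) m ms lz ls) :
    Run w nbrs D good (k + 1) pre l r m ms lz ls := by
  refine .of_step ?_ h
  simp only [step, cfg, prog_code hc, Config.assign, ha, if_true, hx, Nat.mod_eq_of_lt hw]
  rfl

theorem Run.store {a b : Reg} (y x : ℕ) (hc : code l = .store a b l') (hy : r a = y) (hx : r b = x)
    (ha : y < ms)
    (h : Run w nbrs D good k pre l' r (Function.update m y (some x)) ms lz ls) :
    Run w nbrs D good (k + 1) pre l r m ms lz ls := by
  subst hx hy
  refine .of_step ?_ h
  simp only [step, cfg, prog_code hc, Config.goto, ha, if_true]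

theorem Run.lazyReserve {d a : Reg} (x : ℕ) (hc : code l = .lazyReserve d a l') (hx : r a = x)
    (hw : ls + x < 2 ^ w)
    (h : Run w nbrs D good k pre l' (Function.update r d ls) m ms lz (ls + x)) :
    Run w nbrs D good (k + 1) pre l r m ms lz ls := by
  subst hx
  refine .of_step ?_ h
  have h1 : ls < 2 ^ w := by omega
  simp only [step, cfg, prog_code hc, Config.assign, hw.le, if_true, Nat.mod_eq_of_lt h1]
  rfl

/-- The reduction modulo `2 ^ w` stays here, since nothing is assumed about the content of lazy
cells. -/
theorem Run.lazyLoad {d a : Reg} (hc : code l = .lazyLoad d a l') (ha : r a < ls)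
    (h : Run w nbrs D good k pre l' (Function.update r d (lz (r a) % 2 ^ w)) m ms lz ls) :
    Run w nbrs D good (k + 1) pre l r m ms lz ls := by
  refine .of_step ?_ h
  simp only [step, cfg, prog_code hc, Config.assign, ha, if_true]
  rfl

theorem Run.lazyStore {a b : Reg} (y x : ℕ) (hc : code l = .lazyStore a b l') (hy : r a = y)
    (hx : r b = x) (ha : y < ls)
    (h : Run w nbrs D good k pre l' r m ms (Function.update lz y x) ls) :
    Run w nbrs D good (k + 1) pre l r m ms lz ls := by
  subst hx hy
  refine .of_step ?_ h
  simp only [step, cfg, prog_code hc, Config.goto, ha, if_true]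

theorem Run.emit {s t x : Reg} (hc : code l = .emit s t x l')
    (h : Run w nbrs D good D (pre ++ [(r s, r t, (r x : ℕ∞))]) l' r m ms lz ls) :
    Run w nbrs D good (k + 1) pre l r m ms lz ls := by
  refine .of_emit ?_ h
  simp only [step, cfg, prog_code hc, Config.goto]

theorem Run.emitInf {s t : Reg} (hc : code l = .emitInf s t l')
    (h : Run w nbrs D good D (pre ++ [(r s, r t, ⊤)]) l' r m ms lz ls) :
    Run w nbrs D good (k + 1) pre l r m ms lz ls := by
  refine .of_emit ?_ h
  simp only [step, cfg, prog_code hc, Config.goto]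

/-! ### Tables of known pairs -/

/-- The key of a pair of vertices. -/
def cell {n : ℕ} (s t : Fin n) : ℕ := (s : ℕ) * n + t + 1

theorem cell_injective {n : ℕ} {s t s' t' : Fin n} (h : cell s t = cell s' t') :
    s = s' ∧ t = t' := by
  have h' : (s : ℕ) * n + t = (s' : ℕ) * n + t' := by simpa [cell] using h
  have hn : 0 < n := s.pos
  have e1 : (s : ℕ) = s' := by
    have := congrArg (· / n) h'
    simpa [Nat.add_div_of_dvd_right (Dvd.intro_left _ rfl), hn.ne', Nat.div_eq_of_lt] using this
  refine ⟨Fin.ext e1, Fin.ext ?_⟩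
  rw [e1] at h'
  omega

theorem cell_lt {n : ℕ} (s t : Fin n) {c : ℕ} (h : (s : ℕ) < c) : cell s t ≤ c * n := by
  have h1 : ((s : ℕ) + 1) * n ≤ c * n := Nat.mul_le_mul_right n h
  have h2 := t.2
  rw [Nat.succ_mul] at h1
  unfold cell
  omega

/-- A table of records: the numbers of the records in use are those below `dc` and those from `n`
up to `tl`, and they hold a pair of vertices with its distance each. -/
structure Table (n : ℕ) where
  dc : ℕ
  tl : ℕ
  src : ℕ → Fin n
  tgt : ℕ → Fin n
  lab : ℕ → ℕ

namespace Table

variable (T : Table n)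

/-- The record number `i` is in use. -/
def Valid (i : ℕ) : Prop := i < T.dc ∨ (n ≤ i ∧ i < T.tl)

/-- The key of the pair in the record number `i`. -/
def key (i : ℕ) : ℕ := cell (T.src i) (T.tgt i)

/-- There is a record for the pair with key `x`. -/
def Vis (x : ℕ) : Prop := ∃ i, T.Valid i ∧ T.key i = x

theorem one_le_key (i : ℕ) : 1 ≤ T.key i := by unfold key cell; omega

theorem not_vis_zero : ¬ T.Vis 0 := by
  rintro ⟨i, -, h⟩
  have := T.one_le_key i
  omega

/-- The memory holds the records of the table, the numbers of the records, and, at the left end of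
each maximal interval of known keys, the address of the record at the right end, and vice versa. -/
structure Stored (m : ℕ → Option ℕ) (lz : ℕ → ℕ) : Prop where
  key : ∀ i, T.Valid i → m (8 * i) = some (T.key i)
  src : ∀ i, T.Valid i → m (8 * i + 1) = some (T.src i : ℕ)
  tgt : ∀ i, T.Valid i → m (8 * i + 2) = some (T.tgt i : ℕ)
  lab : ∀ i, T.Valid i → m (8 * i + 3) = some (T.lab i)
  idx : ∀ i, T.Valid i → lz (T.key i) = i
  right : ∀ i, T.Valid i → ¬ T.Vis (T.key i - 1) → ∃ j, T.Valid j ∧ m (8 * i + 5) = some (8 * j) ∧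
    T.key i ≤ T.key j ∧ (∀ x, T.key i ≤ x → x ≤ T.key j → T.Vis x) ∧ ¬ T.Vis (T.key j + 1)
  left : ∀ i, T.Valid i → ¬ T.Vis (T.key i + 1) → ∃ j, T.Valid j ∧ m (8 * i + 4) = some (8 * j) ∧
    T.key j ≤ T.key i ∧ (∀ x, T.key j ≤ x → x ≤ T.key i → T.Vis x) ∧ ¬ T.Vis (T.key j - 1)

variable {T}

/-- The lazy cell of a key holds a single record number. -/
theorem Stored.key_injOn {m : ℕ → Option ℕ} {lz : ℕ → ℕ} (h : T.Stored m lz) {i j : ℕ}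
    (hi : T.Valid i) (hj : T.Valid j) (e : T.key i = T.key j) : i = j := by
  rw [← h.idx i hi, ← h.idx j hj, e]

/-- `T'` is `T` with a new record number `e` for a pair that was not known. -/
structure Extends (T' T : Table n) (e : ℕ) : Prop where
  valid : ∀ i, T'.Valid i ↔ T.Valid i ∨ i = e
  new : ¬ T.Valid e
  src : ∀ i, i ≠ e → T'.src i = T.src i
  tgt : ∀ i, i ≠ e → T'.tgt i = T.tgt i
  lab : ∀ i, i ≠ e → T'.lab i = T.lab i
  notVis : ¬ T.Vis (T'.key e)

namespace Extends

variable {T' : Table n} {e : ℕ}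

theorem ne (h : Extends T' T e) {i : ℕ} (hi : T.Valid i) : i ≠ e := by
  rintro rfl
  exact h.new hi

theorem key (h : Extends T' T e) {i : ℕ} (hi : i ≠ e) : T'.key i = T.key i := by
  unfold Table.key
  rw [h.src i hi, h.tgt i hi]

theorem vis (h : Extends T' T e) (x : ℕ) : T'.Vis x ↔ T.Vis x ∨ x = T'.key e := by
  constructor
  · rintro ⟨i, hi, rfl⟩
    by_cases hie : i = e
    · exact .inr (by rw [hie])
    · exact .inl ⟨i, ((h.valid i).1 hi).resolve_right hie, (h.key hie).symm⟩
  · rintro (⟨i, hi, rfl⟩ | rfl)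
    · exact ⟨i, (h.valid i).2 (.inl hi), h.key (h.ne hi)⟩
    · exact ⟨e, (h.valid e).2 (.inr rfl), rfl⟩

end Extends

/-! ### Merging intervals of known keys -/

/-- `i` is the left end of the interval of keys that becomes maximal with the new record `e`. -/
def IsLeftEnd (T' T : Table n) (e i : ℕ) : Prop :=
  (i = e ∧ ¬ T.Vis (T'.key e - 1)) ∨
    (T.Valid i ∧ T.key i ≤ T'.key e - 1 ∧ (∀ x, T.key i ≤ x → x ≤ T'.key e - 1 → T.Vis x) ∧
      ¬ T.Vis (T.key i - 1))

/-- `i` is the right end of the interval of keys that becomes maximal with the new record `e`. -/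
def IsRightEnd (T' T : Table n) (e i : ℕ) : Prop :=
  (i = e ∧ ¬ T.Vis (T'.key e + 1)) ∨
    (T.Valid i ∧ T'.key e + 1 ≤ T.key i ∧ (∀ x, T'.key e + 1 ≤ x → x ≤ T.key i → T.Vis x) ∧
      ¬ T.Vis (T.key i + 1))

section

variable {T' : Table n} {e i : ℕ}

theorem IsLeftEnd.spec (hx : Extends T' T e) (h : IsLeftEnd T' T e i) :
    T'.Valid i ∧ T'.key i ≤ T'.key e ∧ (∀ x, T'.key i ≤ x → x ≤ T'.key e → T'.Vis x) ∧
      ¬ T'.Vis (T'.key i - 1) := by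
  have h1 := T'.one_le_key e
  obtain ⟨rfl, h⟩ | ⟨hv, hle, hi, hn⟩ := h
  · refine ⟨(hx.valid _).2 (.inr rfl), le_rfl, fun x h1 h2 => ?_, ?_⟩
    · exact (hx.vis x).2 (.inr (le_antisymm h2 h1))
    · rw [hx.vis]
      rintro (h' | h')
      · exact h h'
      · omega
  · have hk := hx.key (hx.ne hv)
    refine ⟨(hx.valid _).2 (.inl hv), by omega, fun x h1 h2 => ?_, ?_⟩
    · rw [hx.vis]
      rcases eq_or_ne x (T'.key e) with h' | h'
      · exact .inr h'
      · exact .inl (hi x (by omega) (by omega))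
    · rw [hx.vis, hk]
      rintro (h' | h')
      · exact hn h'
      · omega

theorem IsRightEnd.spec (hx : Extends T' T e) (h : IsRightEnd T' T e i) :
    T'.Valid i ∧ T'.key e ≤ T'.key i ∧ (∀ x, T'.key e ≤ x → x ≤ T'.key i → T'.Vis x) ∧
      ¬ T'.Vis (T'.key i + 1) := by
  obtain ⟨rfl, h⟩ | ⟨hv, hle, hi, hn⟩ := h
  · refine ⟨(hx.valid _).2 (.inr rfl), le_rfl, fun x h1 h2 => ?_, ?_⟩
    · exact (hx.vis x).2 (.inr (le_antisymm h2 h1))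
    · rw [hx.vis]
      rintro (h' | h')
      · exact h h'
      · omega
  · have hk := hx.key (hx.ne hv)
    refine ⟨(hx.valid _).2 (.inl hv), by omega, fun x h1 h2 => ?_, ?_⟩
    · rw [hx.vis]
      rcases eq_or_ne x (T'.key e) with h' | h'
      · exact .inr h'
      · exact .inl (hi x (by omega) (by omega))
    · rw [hx.vis, hk]
      rintro (h' | h')
      · exact hn h'
      · omega

/-- The memory after writing the record number `e` with `il` and `ir` at the ends of its interval. -/
def writeRecord (T' : Table n) (e il ir : ℕ) (m : ℕ → Option ℕ) : ℕ → Option ℕ :=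
  Function.update (Function.update (Function.update (Function.update (Function.update
    (Function.update m (8 * e) (some (T'.key e))) (8 * e + 1) (some (T'.src e : ℕ)))
    (8 * e + 2) (some (T'.tgt e : ℕ))) (8 * e + 3) (some (T'.lab e)))
    (8 * il + 5) (some (8 * ir))) (8 * ir + 4) (some (8 * il))

theorem writeRecord_of_ne (T' : Table n) {e il ir : ℕ} (m : ℕ → Option ℕ) {a : ℕ}
    (h : a / 8 ≠ e) (hl : a ≠ 8 * il + 5) (hr : a ≠ 8 * ir + 4) :
    writeRecord T' e il ir m a = m a := by
  unfold writeRecord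
  iterate 6 rw [Function.update_of_ne (by omega)]

/-- Only the pointers at the two outer ends of the merged interval have to change. Any other maximal
interval is not adjacent to the new key and survives. Pointers of records that become interior go
stale, which is harmless because `Stored` constrains only the ends. -/
theorem Stored.insert {m : ℕ → Option ℕ} {lz : ℕ → ℕ} {il ir : ℕ} (h : T.Stored m lz)
    (hx : Extends T' T e) (hl : IsLeftEnd T' T e il) (hr : IsRightEnd T' T e ir) :
    T'.Stored (writeRecord T' e il ir m) (Function.update lz (T'.key e) e) := by
  obtain ⟨lv, lle, lvis, ln⟩ := hl.spec hx
  obtain ⟨rv, rle, rvis, rn⟩ := hr.spec hx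
  have hvis : ∀ x, T'.key il ≤ x → x ≤ T'.key ir → T'.Vis x := fun x h1 h2 => by
    rcases le_total x (T'.key e) with h3 | h3
    · exact lvis x h1 h3
    · exact rvis x h3 h2
  have h0 := T'.one_le_key e
  constructor
  · intro i hi
    by_cases hie : i = e
    · subst hie
      unfold writeRecord
      iterate 5 rw [Function.update_of_ne (by omega)]
      rw [Function.update_self]
    · rw [writeRecord_of_ne _ _ (by omega) (by omega) (by omega), hx.key hie,
        h.key i (((hx.valid i).1 hi).resolve_right hie)]
  · intro i hi
    by_cases hie : i = e
    · subst hie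
      unfold writeRecord
      iterate 4 rw [Function.update_of_ne (by omega)]
      rw [Function.update_self]
    · rw [writeRecord_of_ne _ _ (by omega) (by omega) (by omega), hx.src i hie,
        h.src i (((hx.valid i).1 hi).resolve_right hie)]
  · intro i hi
    by_cases hie : i = e
    · subst hie
      unfold writeRecord
      iterate 3 rw [Function.update_of_ne (by omega)]
      rw [Function.update_self]
    · rw [writeRecord_of_ne _ _ (by omega) (by omega) (by omega), hx.tgt i hie,
        h.tgt i (((hx.valid i).1 hi).resolve_right hie)]
  · intro i hi
    by_cases hie : i = e
    · subst hie
      unfold writeRecord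
      iterate 2 rw [Function.update_of_ne (by omega)]
      rw [Function.update_self]
    · rw [writeRecord_of_ne _ _ (by omega) (by omega) (by omega), hx.lab i hie,
        h.lab i (((hx.valid i).1 hi).resolve_right hie)]
  · intro i hi
    by_cases hie : i = e
    · rw [hie, Function.update_self]
    · have hv := ((hx.valid i).1 hi).resolve_right hie
      have hne : T.key i ≠ T'.key e := fun h' => hx.notVis ⟨i, hv, h'⟩
      rw [hx.key hie, Function.update_of_ne hne, h.idx i hv]
  · intro i hi hn
    by_cases hil : i = il
    · subst hil
      refine ⟨ir, rv, ?_, by omega, hvis, rn⟩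
      unfold writeRecord
      rw [Function.update_of_ne (by omega), Function.update_self]
    -- If `e` is not `il`, then its left neighbour is known, so that `e` cannot be a left end.
    · have hie : i ≠ e := by
        rintro rfl
        obtain ⟨h', -⟩ | ⟨hv, hle, hi', -⟩ := hl
        · exact hil h'.symm
        · exact hn ((hx.vis _).2 (.inl (hi' _ hle le_rfl)))
      have hv := ((hx.valid i).1 hi).resolve_right hie
      have hki := hx.key hie
      obtain ⟨j, hj, hm, hle, hvis', hnj⟩ := h.right i hv fun h' => hn ((hx.vis _).2 (.inl (hki ▸ h')))
      have hkj := hx.key (hx.ne hj)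
      refine ⟨j, (hx.valid j).2 (.inl hj), ?_, by omega, fun x h1 h2 => ?_, ?_⟩
      · rw [writeRecord_of_ne _ _ (by omega) (by omega) (by omega), hm]
      · exact (hx.vis x).2 (.inl (hvis' x (by omega) (by omega)))
      · rw [hx.vis, hkj]
        rintro (h' | h')
        · exact hnj h'
        -- Now the new key would directly follow the interval from `i` to `j`. Then this interval is
        -- the one merged on the left, contrary to `i ≠ il`.
        have hi1 := T.one_le_key i
        obtain ⟨-, hl⟩ | ⟨hv', hle', hi', hni⟩ := hl
        · exact hl (hvis' _ (by omega) (by omega))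
        · have hne : T.key i ≠ T.key il := fun h' => hil (h.key_injOn hv hv' h')
          have hkil := hx.key (hx.ne hv')
          rcases lt_or_gt_of_ne hne with h3 | h3
          · exact hni (hvis' _ (by omega) (by omega))
          · exact hn ((hx.vis _).2 (.inl (hi' _ (by omega) (by omega))))
  · intro i hi hn
    by_cases hil : i = ir
    · subst hil
      refine ⟨il, lv, ?_, by omega, hvis, ln⟩
      unfold writeRecord
      rw [Function.update_self]
    · have hie : i ≠ e := by
        rintro rfl
        obtain ⟨h', -⟩ | ⟨hv, hle, hi', -⟩ := hr
        · exact hil h'.symm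
        · exact hn ((hx.vis _).2 (.inl (hi' _ le_rfl hle)))
      have hv := ((hx.valid i).1 hi).resolve_right hie
      have hki := hx.key hie
      obtain ⟨j, hj, hm, hle, hvis', hnj⟩ := h.left i hv fun h' => hn ((hx.vis _).2 (.inl (hki ▸ h')))
      have hkj := hx.key (hx.ne hj)
      refine ⟨j, (hx.valid j).2 (.inl hj), ?_, by omega, fun x h1 h2 => ?_, ?_⟩
      · rw [writeRecord_of_ne _ _ (by omega) (by omega) (by omega), hm]
      · exact (hx.vis x).2 (.inl (hvis' x (by omega) (by omega)))
      · rw [hx.vis, hkj]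
        rintro (h' | h')
        · exact hnj h'
        have hj1 := T.one_le_key j
        obtain ⟨-, hr⟩ | ⟨hv', hle', hi', hni⟩ := hr
        · exact hr (hvis' _ (by omega) (by omega))
        · have hne : T.key i ≠ T.key ir := fun h' => hil (h.key_injOn hv hv' h')
          have hkir := hx.key (hx.ne hv')
          rcases lt_or_gt_of_ne hne with h3 | h3
          · exact hn ((hx.vis _).2 (.inl (hi' _ (by omega) (by omega))))
          · exact hni (hvis' _ (by omega) (by omega))

end

end Table

/-! ### Testing and marking pairs -/

variable {T T' : Table n} {e : ℕ}

/-- The records and the keys of the table lie in the reserved memory. -/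
structure Table.Fits (T : Table n) (w ms ls : ℕ) : Prop where
  rec_le : ∀ i, T.Valid i → 8 * i + 8 ≤ ms
  key_lt : ∀ i, T.Valid i → T.key i + 1 < ls
  ms_lt : ms < 2 ^ w
  ls_lt : ls < 2 ^ w

/-- The registers that hold the parameters of the table. -/
structure Params (T : Table n) (r : Reg → ℕ) : Prop where
  n : r .n = n
  one : r .one = 1
  dc : r .dc = T.dc
  tl : r .tl = T.tl

/-- `r'` agrees with `r` on all registers but those changed by `markCode`. -/
def Frame (r r' : Reg → ℕ) : Prop :=
  ∀ y, y ∉ ([.q, .j, .a, .x, .p, .lp, .rp] : List Reg) → r' y = r y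

theorem Frame.refl (r : Reg → ℕ) : Frame r r := fun _ _ => rfl

theorem Frame.update {r r' : Reg → ℕ} (h : Frame r r') {y : Reg}
    (hy : y ∈ ([.q, .j, .a, .x, .p, .lp, .rp] : List Reg)) (v : ℕ) :
    Frame r (Function.update r' y v) := fun z hz => by
  have hne : z ≠ y := fun h' => hz (by rwa [h'])
  rw [Function.update_of_ne hne, h z hz]

theorem Frame.params {r r' : Reg → ℕ} (h : Frame r r') (hp : Params T r) : Params T r' :=
  ⟨(h _ (by decide)).trans hp.n, (h _ (by decide)).trans hp.one, (h _ (by decide)).trans hp.dc,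
    (h _ (by decide)).trans hp.tl⟩

/-- A record with key `q` forces the lazy cell to contain its number. So a word outside the ranges
in use, or one naming a record with another key, proves that `q` is unknown. The range tests also
ensure that only written ordinary cells are loaded. -/
theorem Run.test {b : Site} {q : ℕ} (hs : T.Stored m lz) (hf : T.Fits w ms ls) (hp : Params T r)
    (hq : r .q = q) (hql : q < ls)
    (hyes : ∀ i r', Frame r r' → r' .p = r .p → r' .lp = r .lp → r' .rp = r .rp →
      T.Valid i → T.key i = q → r' .a = 8 * i → Run w nbrs D good k pre (yes b) r' m ms lz ls)
    (hno : ∀ r', Frame r r' → r' .p = r .p → r' .lp = r .lp → r' .rp = r .rp →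
      ¬ T.Vis q → Run w nbrs D good k pre (no b) r' m ms lz ls) :
    Run w nbrs D good (k + 9) pre (.test b 0) r m ms lz ls := by
  obtain ⟨hpn, -, hpd, hpt⟩ := hp
  have hmsw := hf.ms_lt
  refine .lazyLoad rfl (by omega) ?_
  rw [hq]
  set j := lz q % 2 ^ w with hj
  have hjq : ∀ i, T.Valid i → T.key i = q → j = i := fun i hi hiq => by
    have h1 := hs.idx i hi
    have h2 := hf.rec_le i hi
    rw [hj, ← hiq, h1, Nat.mod_eq_of_lt (by omega)]
  have hfr : Frame r (Function.update r .j j) := (Frame.refl r).update (by decide) _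
  have hvalid : T.Valid j → Run w nbrs D good (k + 5) pre (.test b 4) (Function.update r .j j)
      m ms lz ls := fun hv => by
    have h8 := hf.rec_le j hv
    have hlt := hf.key_lt j hv
    have hlsw := hf.ls_lt
    refine .add (2 * j) rfl (by simp; omega) (by omega) ?_
    refine .add (4 * j) rfl (by simp; omega) (by omega) ?_
    refine .add (8 * j) rfl (by simp; omega) (by omega) ?_
    refine .load (T.key j) rfl (by simp; omega) (by simpa using hs.key j hv) (by omega) ?_
    refine .ifEq rfl (fun h => ?_) (fun h => ?_)
    · refine hyes j _ ((((hfr.update (by decide) _).update (by decide) _).update (by decide) _).update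
        (by decide) _) (by simp) (by simp) (by simp) hv (by simpa [hq] using h) (by simp)
    · refine hno _ ((((hfr.update (by decide) _).update (by decide) _).update (by decide) _).update
        (by decide) _) (by simp) (by simp) (by simp) ?_
      rintro ⟨i, hi, hiq⟩
      rw [← hjq i hi hiq] at hiq
      exact h (by simpa [hq] using hiq)
  have hinvalid : ¬ T.Valid j → Run w nbrs D good k pre (no b) (Function.update r .j j)
      m ms lz ls := fun hv => by
    refine hno _ hfr (by simp) (by simp) (by simp) ?_
    rintro ⟨i, hi, hiq⟩
    exact hv (hjq i hi hiq ▸ hi)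
  refine .ifLt rfl (fun h => ?_) (fun h => ?_)
  · exact (hvalid (.inl (by simpa [hpd] using h))).mono (by omega)
  · have h : T.dc ≤ j := by simpa [hpd] using h
    refine .ifLt rfl (fun h' => ?_) (fun h' => ?_)
    · have h' : j < n := by simpa [hpn] using h'
      refine (hinvalid ?_).mono (by omega)
      unfold Table.Valid
      omega
    · have h' : n ≤ j := by simpa [hpn] using h'
      refine .ifLt rfl (fun h'' => ?_) (fun h'' => ?_)
      · have h'' : j < T.tl := by simpa [hpt] using h''
        exact (hvalid (.inr ⟨h', h''⟩)).mono (by omega)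
      · have h'' : T.tl ≤ j := by simpa [hpt] using h''
        refine (hinvalid ?_).mono (by omega)
        unfold Table.Valid
        omega

/-- The registers that hold the new record. -/
structure NewRecord (T' : Table n) (e : ℕ) (r : Reg → ℕ) : Prop where
  k : r .k = T'.key e
  s : r .s = T'.src e
  t : r .t = T'.tgt e
  d1 : r .d1 = T'.lab e
  idx : r .idx = e

theorem Frame.newRecord {r r' : Reg → ℕ} (h : Frame r r') (hp : NewRecord T' e r) :
    NewRecord T' e r' :=
  ⟨(h _ (by decide)).trans hp.k, (h _ (by decide)).trans hp.s, (h _ (by decide)).trans hp.t,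
    (h _ (by decide)).trans hp.d1, (h _ (by decide)).trans hp.idx⟩

/-- All stores come after both neighbour tests: the tests see the memory of `T`, and the stores lead
to that of `T'` in one go. -/
theorem Run.mark_write {il ir : ℕ} {r₀ : Reg → ℕ} (hs : T.Stored m lz) (hx : T'.Extends T e)
    (hf : T'.Fits w ms ls)
    (hp : Params T r) (hr : NewRecord T' e r) (hfr : Frame r₀ r)
    (hl : Table.IsLeftEnd T' T e il) (hrt : Table.IsRightEnd T' T e ir)
    (hpp : r .p = 8 * e) (hlp : r .lp = 8 * il) (hrp : r .rp = 8 * ir)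
    (h : ∀ r' m' lz', Frame r₀ r' → T'.Stored m' lz' →
      Run w nbrs D good k pre (.mark 27) r' m' ms lz' ls) :
    Run w nbrs D good (k + 14) pre (.mark 13) r m ms lz ls := by
  obtain ⟨hpn, hp1, hpd, hpt⟩ := hp
  obtain ⟨hrk, hrs, hrt', hrd, hri⟩ := hr
  have h8 := hf.rec_le e ((hx.valid e).2 (.inr rfl))
  have h8l := hf.rec_le il (hl.spec hx).1
  have h8r := hf.rec_le ir (hrt.spec hx).1
  have hk := hf.key_lt e ((hx.valid e).2 (.inr rfl))
  have hmsw := hf.ms_lt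
  refine .store (8 * e) (T'.key e) rfl hpp hrk (by omega) ?_
  refine .add (8 * e + 1) rfl (by simp [*]) (by omega) ?_
  refine .store (8 * e + 1) (T'.src e) rfl (by simp) (by simp [*]) (by omega) ?_
  refine .add (8 * e + 2) rfl (by simp [*]) (by omega) ?_
  refine .store (8 * e + 2) (T'.tgt e) rfl (by simp) (by simp [*]) (by omega) ?_
  refine .add (8 * e + 3) rfl (by simp [*]) (by omega) ?_
  refine .store (8 * e + 3) (T'.lab e) rfl (by simp) (by simp [*]) (by omega) ?_
  refine .lazyStore (T'.key e) e rfl (by simp [*]) (by simp [*]) (by omega) ?_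
  refine .const rfl (by omega) ?_
  refine .add (8 * il + 5) rfl (by simp [*]) (by omega) ?_
  refine .store (8 * il + 5) (8 * ir) rfl (by simp) (by simp [*]) (by omega) ?_
  refine .const rfl (by omega) ?_
  refine .add (8 * ir + 4) rfl (by simp [*]) (by omega) ?_
  refine .store (8 * ir + 4) (8 * il) rfl (by simp) (by simp [*]) (by omega) ?_
  refine h _ _ _ ?_ (hs.insert hx hl hrt)
  iterate 7 refine Frame.update ?_ (by decide) _
  exact hfr

theorem Run.mark_right {il : ℕ} {r₀ : Reg → ℕ} (hs : T.Stored m lz) (hx : T'.Extends T e)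
    (hf : T.Fits w ms ls) (hf' : T'.Fits w ms ls)
    (hp : Params T r) (hr : NewRecord T' e r) (hfr : Frame r₀ r)
    (hl : Table.IsLeftEnd T' T e il)
    (hpp : r .p = 8 * e) (hlp : r .lp = 8 * il) (hrp : r .rp = 8 * e)
    (h : ∀ r' m' lz', Frame r₀ r' → T'.Stored m' lz' →
      Run w nbrs D good k pre (.mark 27) r' m' ms lz' ls) :
    Run w nbrs D good (k + 27) pre (.mark 9) r m ms lz ls := by
  have hmsw := hf.ms_lt
  have hlsw := hf.ls_lt
  have hk := hf'.key_lt e ((hx.valid e).2 (.inr rfl))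
  have hfr' : Frame r₀ (Function.update r .q (T'.key e + 1)) := hfr.update (by decide) _
  have hfr1 : Frame r (Function.update r .q (T'.key e + 1)) := (Frame.refl r).update (by decide) _
  refine .add (T'.key e + 1) rfl (by simp [hr.k, hp.one]) (by omega) ?_
  refine .test hs hf (hfr1.params hp) (by simp) hk ?_ ?_
  · intro i r' hr' hp' hlp' hrp' hi hiq ha
    have h8 := hf.rec_le i hi
    have hfr2 : Frame r₀ r' := fun y hy => (hr' y hy).trans (hfr' y hy)
    have hfr3 : Frame r r' := fun y hy => (hr' y hy).trans (hfr1 y hy)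
    -- The key before that of `i` is the new one, still unknown in `T`. So `i` is a left end and its
    -- pointer is up to date.
    have hn : ¬ T.Vis (T.key i - 1) := by
      rw [hiq]
      simpa using hx.notVis
    obtain ⟨j, hj, hm, hle, hvis, hnj⟩ := hs.right i hi hn
    have h8j := hf.rec_le j hj
    refine .const rfl (by omega) ?_
    refine .add (8 * i + 5) rfl (by simp [ha]) (by omega) ?_
    refine .load (8 * j) rfl (by simp; omega) (by simpa using hm) (by omega) ?_
    have hfr4 : ∀ v₁ v₂ v₃, Frame r' (Function.update (Function.update (Function.update r' .x v₁)
        .a v₂) .rp v₃) := fun v₁ v₂ v₃ =>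
      (((Frame.refl r').update (by decide) _).update (by decide) _).update (by decide) _
    refine .mark_write (ir := j) hs hx hf' ((hfr4 _ _ _).params (hfr3.params hp))
      ((hfr4 _ _ _).newRecord (hfr3.newRecord hr))
      (fun y hy => (hfr4 _ _ _ y hy).trans (hfr2 y hy)) hl
      (.inr ⟨hj, hiq ▸ hle, hiq ▸ hvis, hnj⟩) ?_ ?_ (by simp) h
    · simpa [hp'] using hpp
    · simpa [hlp'] using hlp
  · intro r' hr' hp' hlp' hrp' hn
    have hfr2 : Frame r₀ r' := fun y hy => (hr' y hy).trans (hfr' y hy)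
    have hfr3 : Frame r r' := fun y hy => (hr' y hy).trans (hfr1 y hy)
    refine Run.mono ?_ (.mark_write hs hx hf' (hfr3.params hp) (hfr3.newRecord hr) hfr2 hl
      (.inl ⟨rfl, hn⟩) ?_ ?_ ?_ h)
    · omega
    · simpa [hp'] using hpp
    · simpa [hlp'] using hlp
    · simpa [hrp'] using hrp

theorem Run.mark (hs : T.Stored m lz) (hx : T'.Extends T e)
    (hf : T.Fits w ms ls) (hf' : T'.Fits w ms ls) (hp : Params T r) (hr : NewRecord T' e r)
    (h : ∀ r' m' lz', Frame r r' → T'.Stored m' lz' →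
      Run w nbrs D good k pre (.mark 27) r' m' ms lz' ls) :
    Run w nbrs D good (k + 45) pre (.mark 0) r m ms lz ls := by
  have hmsw := hf.ms_lt
  have hlsw := hf.ls_lt
  have hk := hf'.key_lt e ((hx.valid e).2 (.inr rfl))
  have h8e := hf'.rec_le e ((hx.valid e).2 (.inr rfl))
  refine .add (2 * e) rfl (by simp [hr.idx]; omega) (by omega) ?_
  refine .add (4 * e) rfl (by simp; omega) (by omega) ?_
  refine .add (8 * e) rfl (by simp; omega) (by omega) ?_
  refine .move (8 * e) rfl (by simp) (by omega) ?_
  refine .move (8 * e) rfl (by simp) (by omega) ?_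
  -- Keys start at `1`, so nothing is truncated; for the key `1` this queries the unused key `0`.
  refine .sub (T'.key e - 1) rfl (by simp [hr.k, hp.one]) (by omega) ?_
  refine .test (q := T'.key e - 1) hs hf ?_ (by simp) (by omega) ?_ ?_
  · refine Frame.params (r := r) ?_ hp
    iterate 6 refine Frame.update ?_ (by decide) _
    exact Frame.refl r
  · intro i r' hr' hp' hlp' hrp' hi hiq ha
    have h8 := hf.rec_le i hi
    have hfr : Frame r r' := fun y hy => by
      refine (hr' y hy).trans (Frame.update ?_ (by decide) _ y hy)
      iterate 5 refine Frame.update ?_ (by decide) _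
      exact Frame.refl r
    have hn : ¬ T.Vis (T.key i + 1) := by
      have := T'.one_le_key e
      rw [hiq, Nat.sub_add_cancel this]
      exact hx.notVis
    obtain ⟨j, hj, hm, hle, hvis, hnj⟩ := hs.left i hi hn
    have h8j := hf.rec_le j hj
    refine .const rfl (by omega) ?_
    refine .add (8 * i + 4) rfl (by simp [ha]) (by omega) ?_
    refine .load (8 * j) rfl (by simp; omega) (by simpa using hm) (by omega) ?_
    have hfr4 : ∀ v₁ v₂ v₃, Frame r (Function.update (Function.update (Function.update r' .x v₁)
        .a v₂) .lp v₃) := fun v₁ v₂ v₃ =>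
      ((hfr.update (by decide) _).update (by decide) _).update (by decide) _
    refine .mark_right (il := j) hs hx hf hf' ((hfr4 _ _ _).params hp)
      ((hfr4 _ _ _).newRecord hr) (hfr4 _ _ _)
      (.inr ⟨hj, hiq ▸ hle, hiq ▸ hvis, hnj⟩) ?_ (by simp) ?_ h
    · simp [hp']
    · simp [hrp']
  · intro r' hr' hp' hlp' hrp' hn
    have hfr : Frame r r' := fun y hy => by
      refine (hr' y hy).trans (Frame.update ?_ (by decide) _ y hy)
      iterate 5 refine Frame.update ?_ (by decide) _
      exact Frame.refl r
    refine Run.mono ?_ (.mark_right hs hx hf hf' (hfr.params hp) (hfr.newRecord hr) hfr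
      (.inl ⟨rfl, hn⟩) ?_ ?_ ?_ h)
    · omega
    · simp [hp']
    · simp [hlp']
    · simp [hrp']

namespace Table

/-! ### Breadth-first search -/

theorem Extends.key_injOn (hx : Extends T' T e)
    (h : ∀ i j, T.Valid i → T.Valid j → T.key i = T.key j → i = j) {i j : ℕ}
    (hi : T'.Valid i) (hj : T'.Valid j) (hk : T'.key i = T'.key j) : i = j := by
  by_cases hie : i = e <;> by_cases hje : j = e
  · rw [hie, hje]
  · subst hie
    rw [hx.key hje] at hk
    exact absurd ⟨j, ((hx.valid j).1 hj).resolve_right hje, hk.symm⟩ hx.notVis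
  · subst hje
    rw [hx.key hie] at hk
    exact absurd ⟨i, ((hx.valid i).1 hi).resolve_right hie, hk⟩ hx.notVis
  · rw [hx.key hie, hx.key hje] at hk
    exact h i j (((hx.valid i).1 hi).resolve_right hie) (((hx.valid j).1 hj).resolve_right hje) hk

/-- The queued records have distinct keys between `1` and `c * n`. Hence reserving `n` further
records with each row is enough. -/
theorem tl_le {c : ℕ} (hinj : ∀ i j, T.Valid i → T.Valid j → T.key i = T.key j → i = j)
    (hrow : ∀ i, T.Valid i → (T.src i : ℕ) < c) : T.tl ≤ n + c * n := by
  have h : (Finset.Ico n T.tl).card ≤ (Finset.Icc 1 (c * n)).card := by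
    refine Finset.card_le_card_of_injOn T.key (fun i hi => ?_) (fun i hi j hj hij => ?_)
    · have hv : T.Valid i := .inr (Finset.mem_Ico.1 hi)
      exact Finset.mem_coe.2 (Finset.mem_Icc.2 ⟨T.one_le_key i, cell_lt _ _ (hrow i hv)⟩)
    · exact hinj i j (.inr (Finset.mem_Ico.1 hi)) (.inr (Finset.mem_Ico.1 hj)) hij
  simp only [Nat.card_Ico, Nat.card_Icc] at h
  omega

theorem fits {c w : ℕ} (hinj : ∀ i j, T.Valid i → T.Valid j → T.key i = T.key j → i = j)
    (hrow : ∀ i, T.Valid i → (T.src i : ℕ) < c) (hdc : T.dc ≤ n)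
    (hms : 8 * n + 8 * (c * n) < 2 ^ w) (hls : 2 + c * n < 2 ^ w) :
    T.Fits w (8 * n + 8 * (c * n)) (2 + c * n) := by
  have htl := tl_le hinj hrow
  refine ⟨fun i hi => ?_, fun i hi => ?_, hms, hls⟩
  · obtain hi | hi := hi <;> omega
  · have := cell_lt (T.src i) (T.tgt i) (hrow i hi)
    unfold key
    omega

/-- The state of the breadth-first search when the records below `dc` and those from `n` up to `hd`
have been emitted and the last one of them has the distance `d`. -/
structure Queue (T : Table n) (G : Digraph (Fin n)) (hd d : ℕ) : Prop where
  dc_le : T.dc ≤ n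
  n_le : n ≤ hd
  hd_le : hd ≤ T.tl
  diag : ∀ i < T.dc, (T.src i : ℕ) = i ∧ T.tgt i = T.src i ∧ T.lab i = 0
  row : ∀ i, T.Valid i → (T.src i : ℕ) < T.dc
  walk : ∀ i, T.Valid i → IsWalk G (T.lab i) (T.src i) (T.tgt i)
  mono : ∀ i j, n ≤ i → i ≤ j → j < T.tl → T.lab i ≤ T.lab j
  le_succ : ∀ i, n ≤ i → i < T.tl → T.lab i ≤ d + 1
  le_lab : ∀ i, hd ≤ i → i < T.tl → d ≤ T.lab i
  -- A label is bounded by its position in the queue; this keeps labels within a word before they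
  -- are known to be distances.
  lab_add_le : ∀ i, n ≤ i → i < T.tl → T.lab i + n ≤ i + 1
  -- Nothing is popped while a pair `(s, s)` is missing, so its distance `0` still comes in order.
  start : T.dc < n → hd = n ∧ d = 0
  add_le : d + n ≤ hd

/-- All pairs reached by an edge from the pair in the record number `i` are known. -/
def Closed (T : Table n) (G : Digraph (Fin n)) (i : ℕ) : Prop :=
  ∀ v, G.Adj (T.tgt i) v →
    ∃ j, T.Valid j ∧ T.src j = T.src i ∧ T.tgt j = v ∧ T.lab j ≤ T.lab i + 1

theorem Extends.exists_record (hx : Extends T' T e) {s v : Fin n} {d : ℕ}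
    (h : ∃ j, T.Valid j ∧ T.src j = s ∧ T.tgt j = v ∧ T.lab j ≤ d) :
    ∃ j, T'.Valid j ∧ T'.src j = s ∧ T'.tgt j = v ∧ T'.lab j ≤ d := by
  obtain ⟨j, hj, h1, h2, h3⟩ := h
  have hne := hx.ne hj
  exact ⟨j, (hx.valid j).2 (.inl hj), (hx.src j hne).trans h1, (hx.tgt j hne).trans h2,
    (hx.lab j hne).le.trans h3⟩

theorem Extends.closed (hx : Extends T' T e) {G : Digraph (Fin n)} {i : ℕ} (hi : i ≠ e)
    (h : T.Closed G i) : T'.Closed G i := fun v hv => by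
  rw [hx.tgt i hi] at hv
  rw [hx.src i hi, hx.lab i hi]
  exact hx.exists_record (h v hv)

/-- Append a record to the queue. -/
def push (T : Table n) (s t : Fin n) (l : ℕ) : Table n where
  dc := T.dc
  tl := T.tl + 1
  src := Function.update T.src T.tl s
  tgt := Function.update T.tgt T.tl t
  lab := Function.update T.lab T.tl l

/-- Add the record of the next pair `(s, s)`. -/
def addDiag (T : Table n) (h : T.dc < n) : Table n where
  dc := T.dc + 1
  tl := T.tl
  src := Function.update T.src T.dc ⟨T.dc, h⟩
  tgt := Function.update T.tgt T.dc ⟨T.dc, h⟩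
  lab := Function.update T.lab T.dc 0

theorem push_extends {s t : Fin n} {l : ℕ} (hdc : T.dc ≤ n) (htl : n ≤ T.tl)
    (h : ¬ T.Vis (cell s t)) : (T.push s t l).Extends T T.tl where
  valid i := by
    simp only [Valid, push]
    omega
  new := by
    unfold Valid
    omega
  src i hi := Function.update_of_ne hi _ _
  tgt i hi := Function.update_of_ne hi _ _
  lab i hi := Function.update_of_ne hi _ _
  notVis := by simpa [key, push] using h

/-- The search from the source `T.dc` has not begun: all records have smaller sources. -/
theorem addDiag_extends (h : T.dc < n) (hrow : ∀ i, T.Valid i → (T.src i : ℕ) < T.dc) :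
    (T.addDiag h).Extends T T.dc where
  valid i := by
    simp only [Valid, addDiag]
    omega
  new := by
    unfold Valid
    omega
  src i hi := Function.update_of_ne hi _ _
  tgt i hi := Function.update_of_ne hi _ _
  lab i hi := Function.update_of_ne hi _ _
  notVis := by
    rintro ⟨i, hi, hk⟩
    have h1 := hrow i hi
    have h2 := (cell_injective hk).1
    rw [h2] at h1
    simp [addDiag] at h1

variable {G : Digraph (Fin n)} {hd d : ℕ}

theorem _root_.IsWalk.snoc {V : Type} {G : Digraph V} {k : ℕ} {s t u : V} (h : IsWalk G k s t)
    (hu : G.Adj t u) : IsWalk G (k + 1) s u := by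
  induction h with
  | nil s => exact .cons hu (.nil u)
  | cons h1 _ ih => exact .cons h1 (ih hu)

/-- No queued label exceeds `d + 1`, so appending `d + 1` keeps the queue sorted. The required walk
is that of the record `c` prolonged by an edge. -/
theorem Queue.push (h : T.Queue G hd d) {c : ℕ} {s v : Fin n} (hc : T.Valid c) (hs : T.src c = s)
    (hd' : T.lab c = d) (hv : G.Adj (T.tgt c) v) (hn : ¬ T.Vis (cell s v)) :
    (T.push s v (d + 1)).Queue G hd d := by
  have h1 := h.n_le
  have h2 := h.hd_le
  have hx := push_extends (l := d + 1) h.dc_le (h1.trans h2) hn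
  have hne : ∀ {i}, i < T.tl → i ≠ T.tl := fun h => h.ne
  have e1 : (T.push s v (d + 1)).src T.tl = s := Function.update_self _ _ _
  have e2 : (T.push s v (d + 1)).tgt T.tl = v := Function.update_self _ _ _
  have e3 : (T.push s v (d + 1)).lab T.tl = d + 1 := Function.update_self _ _ _
  have hcases : ∀ {i}, i < (T.push s v (d + 1)).tl → i < T.tl ∨ i = T.tl := fun {i} hi =>
    (Nat.lt_succ_iff_lt_or_eq.1 hi)
  refine ⟨h.dc_le, h1, h2.trans (Nat.le_succ _), fun i hi => ?_, fun i hi => ?_, fun i hi => ?_,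
    fun i j hi hij hj => ?_, fun i hi hi' => ?_, fun i hi hi' => ?_, fun i hi hi' => ?_, h.start,
    h.add_le⟩
  · have hi' : i < T.dc := hi
    have := h.dc_le
    have hne : i ≠ T.tl := by omega
    rw [hx.src i hne, hx.tgt i hne, hx.lab i hne]
    exact h.diag i hi
  · obtain hi | rfl := (hx.valid i).1 hi
    · rw [hx.src i (hx.ne hi)]
      exact h.row i hi
    · rw [e1, ← hs]
      exact h.row c hc
  · obtain hi | rfl := (hx.valid i).1 hi
    · rw [hx.src i (hx.ne hi), hx.tgt i (hx.ne hi), hx.lab i (hx.ne hi)]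
      exact h.walk i hi
    · rw [e1, e2, e3, ← hs, ← hd']
      exact (h.walk c hc).snoc hv
  · obtain hj | rfl := hcases hj
    · rw [hx.lab i (by omega), hx.lab j (by omega)]
      exact h.mono i j hi hij hj
    · rw [e3]
      obtain hij | rfl := hij.lt_or_eq
      · rw [hx.lab i (by omega)]
        exact h.le_succ i hi hij
      · rw [e3]
  · obtain hi' | rfl := hcases hi'
    · rw [hx.lab i (by omega)]
      exact h.le_succ i hi hi'
    · rw [e3]
  · obtain hi' | rfl := hcases hi'
    · rw [hx.lab i (by omega)]
      exact h.le_lab i hi hi'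
    · rw [e3]
      omega
  · obtain hi' | rfl := hcases hi'
    · rw [hx.lab i (by omega)]
      exact h.lab_add_le i hi hi'
    · rw [e3]
      have := h.add_le
      omega

theorem Queue.addDiag (h : T.Queue G hd d) (hlt : T.dc < n) : (T.addDiag hlt).Queue G hd d := by
  have h1 := h.n_le
  have h2 := h.hd_le
  have hx := addDiag_extends hlt h.row
  have e1 : (T.addDiag hlt).src T.dc = ⟨T.dc, hlt⟩ := Function.update_self _ _ _
  have e2 : (T.addDiag hlt).tgt T.dc = ⟨T.dc, hlt⟩ := Function.update_self _ _ _
  have e3 : (T.addDiag hlt).lab T.dc = 0 := Function.update_self _ _ _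
  refine ⟨hlt, h1, h2, fun i hi => ?_, fun i hi => ?_, fun i hi => ?_,
    fun i j hi hij hj => ?_, fun i hi hi' => ?_, fun i hi hi' => ?_, fun i hi hi' => ?_,
    fun _ => h.start hlt, h.add_le⟩
  · obtain hi | rfl := Nat.lt_succ_iff_lt_or_eq.1 hi
    · rw [hx.src i hi.ne, hx.tgt i hi.ne, hx.lab i hi.ne]
      exact h.diag i hi
    · rw [e1, e2, e3]
      simp
  · obtain hi | rfl := (hx.valid i).1 hi
    · rw [hx.src i (hx.ne hi)]
      exact (h.row i hi).trans (Nat.lt_succ_self _)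
    · rw [e1]
      exact Nat.lt_succ_self _
  · obtain hi | rfl := (hx.valid i).1 hi
    · rw [hx.src i (hx.ne hi), hx.tgt i (hx.ne hi), hx.lab i (hx.ne hi)]
      exact h.walk i hi
    · rw [e1, e2, e3]
      exact .nil _
  · rw [hx.lab i (by omega), hx.lab j (by omega)]
    exact h.mono i j hi hij hj
  · rw [hx.lab i (by omega)]
    exact h.le_succ i hi hi'
  · rw [hx.lab i (by omega)]
    exact h.le_lab i hi hi'
  · rw [hx.lab i (by omega)]
    exact h.lab_add_le i hi hi'

theorem Queue.pop (h : T.Queue G hd d) (hdc : T.dc = n) (hlt : hd < T.tl) :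
    T.Queue G (hd + 1) (T.lab hd) := by
  have h1 := h.n_le
  have h3 := h.le_lab hd le_rfl hlt
  refine ⟨h.dc_le, by omega, hlt, h.diag, h.row, h.walk, h.mono, fun i hi hi' => ?_,
    fun i hi hi' => h.mono hd i h1 (by omega) hi', h.lab_add_le, fun h => by omega,
    h.lab_add_le hd h1 hlt⟩
  have := h.le_succ i hi hi'
  omega

/-! ### The list of emitted triples -/

/-- The triple in the record number `i`. -/
def triple (T : Table n) (i : ℕ) : Triple := ((T.src i : ℕ), (T.tgt i : ℕ), (T.lab i : ℕ∞))

/-- The list `pre` consists of the records with numbers in `S`, in sorted order, and all of them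
have distances at most `d`. -/
structure Emitted (T : Table n) (S : ℕ → Prop) (d : ℕ) (pre : List Triple) : Prop where
  nodup : pre.Nodup
  mem : ∀ o, o ∈ pre ↔ ∃ i, S i ∧ o = T.triple i
  sorted : pre.Pairwise fun o o' => o.2.2 ≤ o'.2.2
  le : ∀ o ∈ pre, o.2.2 ≤ (d : ℕ∞)

variable {S S' : ℕ → Prop}

theorem Emitted.extends (h : T.Emitted S d pre) (hx : T'.Extends T e) (he : ¬ S e) :
    T'.Emitted S d pre := by
  refine ⟨h.nodup, fun o => (h.mem o).trans ?_, h.sorted, h.le⟩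
  refine exists_congr fun i => and_congr_right fun hi => ?_
  have hne : i ≠ e := by
    rintro rfl
    exact he hi
  rw [triple, triple, hx.src i hne, hx.tgt i hne, hx.lab i hne]

theorem triple_injective {i j : ℕ} (h : T.triple i = T.triple j) : T.key i = T.key j := by
  simp only [triple, Prod.mk.injEq] at h
  rw [key, key, Fin.ext h.1, Fin.ext h.2.1]

theorem Emitted.append (h : T.Emitted S d pre) (hS : ∀ i, S' i ↔ S i ∨ i = e)
    (hk : ∀ i, S i → T.key i ≠ T.key e) (hd : d ≤ T.lab e) :
    T.Emitted S' (T.lab e) (pre ++ [T.triple e]) := by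
  refine ⟨?_, fun o => ?_, ?_, fun o ho => ?_⟩
  · rw [List.nodup_append]
    refine ⟨h.nodup, List.nodup_singleton _, fun a ha b hb hab => ?_⟩
    rw [List.mem_singleton] at hb
    subst hab hb
    obtain ⟨i, hi, hi'⟩ := (h.mem _).1 ha
    exact hk i hi (triple_injective hi'.symm)
  · rw [List.mem_append, List.mem_singleton, h.mem]
    constructor
    · rintro (⟨i, hi, rfl⟩ | rfl)
      · exact ⟨i, (hS i).2 (.inl hi), rfl⟩
      · exact ⟨e, (hS e).2 (.inr rfl), rfl⟩
    · rintro ⟨i, hi, rfl⟩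
      obtain hi | rfl := (hS i).1 hi
      · exact .inl ⟨i, hi, rfl⟩
      · exact .inr rfl
  · rw [List.pairwise_append]
    refine ⟨h.sorted, List.pairwise_singleton _ _, fun a ha b hb => ?_⟩
    rw [List.mem_singleton] at hb
    subst hb
    exact (h.le a ha).trans (Nat.cast_le.2 hd)
  · rw [List.mem_append, List.mem_singleton] at ho
    obtain ho | rfl := ho
    · exact (h.le o ho).trans (Nat.cast_le.2 hd)
    · exact le_rfl

/-! ### Exactness of the labels -/

theorem exists_record_of_isWalk (hcl : ∀ i, T.Valid i → T.Closed G i) {k : ℕ} {u t : Fin n}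
    (hw : IsWalk G k u t) : ∀ i, T.Valid i → T.tgt i = u →
      ∃ j, T.Valid j ∧ T.src j = T.src i ∧ T.tgt j = t ∧ T.lab j ≤ T.lab i + k := by
  induction hw with
  | nil u => exact fun i hi hu => ⟨i, hi, rfl, hu, le_rfl⟩
  | cons hadj _ ih =>
    intro i hi hu
    subst hu
    obtain ⟨j, hj, h1, h2, h3⟩ := hcl i hi _ hadj
    obtain ⟨j', hj', h1', h2', h3'⟩ := ih j hj h2
    exact ⟨j', hj', h1'.trans h1, h2', by omega⟩

theorem Queue.exists_record (h : T.Queue G hd d) (hdc : T.dc = n)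
    (hcl : ∀ i, T.Valid i → T.Closed G i) {k : ℕ} {s t : Fin n} (hw : IsWalk G k s t) :
    ∃ j, T.Valid j ∧ T.src j = s ∧ T.tgt j = t ∧ T.lab j ≤ k := by
  have hlt : (s : ℕ) < T.dc := by
    rw [hdc]
    exact s.2
  obtain ⟨h1, h2, h3⟩ := h.diag s hlt
  have h1 : T.src s = s := Fin.ext h1
  obtain ⟨j, hj, h4, h5, h6⟩ := exists_record_of_isWalk hcl hw s (.inl hlt) (h2.trans h1)
  exact ⟨j, hj, h4.trans h1, h5, by omega⟩

/-- The walk of the record gives one inequality. Conversely, closedness turns any walk into a record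
of the same pair with a label at most its length, and by injectivity of keys this is the record `i`
itself. -/
theorem Queue.hopDist_eq (h : T.Queue G hd d) (hdc : T.dc = n)
    (hcl : ∀ i, T.Valid i → T.Closed G i)
    (hinj : ∀ i j, T.Valid i → T.Valid j → T.key i = T.key j → i = j) {i : ℕ} (hi : T.Valid i) :
    hopDist G (T.src i) (T.tgt i) = T.lab i := by
  refine le_antisymm (iInf₂_le (T.lab i) (h.walk i hi)) (le_iInf₂ fun k hk => ?_)
  obtain ⟨j, hj, h1, h2, h3⟩ := h.exists_record hdc hcl hk
  rw [hinj i j hi hj (by rw [key, key, h1, h2])]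
  exact Nat.cast_le.2 h3

theorem Queue.hopDist_eq_top (h : T.Queue G hd d) (hdc : T.dc = n)
    (hcl : ∀ i, T.Valid i → T.Closed G i) {s t : Fin n} (hn : ¬ T.Vis (cell s t)) :
    hopDist G s t = ⊤ := by
  simp only [hopDist, iInf_eq_top]
  intro k hk
  obtain ⟨j, hj, h1, h2, -⟩ := h.exists_record hdc hcl hk
  exact absurd ⟨j, hj, by rw [key, h1, h2]⟩ hn

end Table

/-! ### The main loop -/

variable {G : Digraph (Fin n)} {hd d : ℕ}

/-- The record number `i` has been emitted. -/
def Table.Done (T : Table n) (hd i : ℕ) : Prop := i < T.dc ∨ (n ≤ i ∧ i < hd)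

theorem Table.Queue.valid_of_done (h : T.Queue G hd d) {i : ℕ} (hi : T.Done hd i) : T.Valid i := by
  have := h.hd_le
  unfold Table.Valid
  unfold Table.Done at hi
  omega

/-- The registers and the memory in the main loop. -/
structure State (T : Table n) (G : Digraph (Fin n)) (hd d : ℕ) (pre : List Triple) (r : Reg → ℕ)
    (m : ℕ → Option ℕ) (lz : ℕ → ℕ) : Prop where
  queue : T.Queue G hd d
  stored : T.Stored m lz
  emitted : T.Emitted (T.Done hd) d pre
  params : Params T r
  zero : r .zero = 0
  n8 : r .n8 = 8 * n
  hd : r .hd = hd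
  nb : r .nb = T.dc * n + 1

/-- The run from the main loop, with all emitted records being closed. -/
def LoopRun (w : ℕ) (nbrs : Fin n → List (Fin n)) (D : ℕ) (good : List Triple → ℕ → ℕ → Prop)
    (G : Digraph (Fin n)) (c hd d : ℕ) (pre : List Triple) : Prop :=
  -- The table is quantified because a scan pushes records, while it leaves `c`, `hd`, `d` and `pre`
  -- unchanged.
  ∀ (T : Table n) (r : Reg → ℕ) (m : ℕ → Option ℕ) (lz : ℕ → ℕ), T.dc = c →
    State T G hd d pre r m lz → (∀ i, T.Done hd i → T.Closed G i) →
    Run w nbrs D good 100 pre .loop r m (8 * n + 8 * (c * n)) lz (2 + c * n)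

/-- The registers while the neighbours of the pair in the record number `c` are scanned. -/
structure ScanRegs (T : Table n) (c d i deg : ℕ) (r : Reg → ℕ) : Prop where
  s : r .s = T.src c
  u : r .u = T.tgt c
  d1 : r .d1 = d + 1
  base : r .base = T.src c * n + 1
  deg : r .deg = deg
  i : r .i = i

theorem State.fits (h : State T G hd d pre r m lz) (hw : 8 * n + 8 * (n * n) + 100 < 2 ^ w) :
    T.Fits w (8 * n + 8 * (T.dc * n)) (2 + T.dc * n) := by
  have := Nat.mul_le_mul_right n h.queue.dc_le
  exact Table.fits (fun i j => h.stored.key_injOn) h.queue.row h.queue.dc_le (by omega) (by omega)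

/-- The induction is on the number of unread entries. An entry costs at most 70 steps; the constant
101 is the final test plus the budget of `LoopRun`. Among the emitted records only `c` need not be
closed yet, and the condition on the positions `p < i` becomes its closedness when the list is
exhausted. -/
theorem Run.scan {c : ℕ} (hw : 8 * n + 8 * (n * n) + 100 < 2 ^ w)
    (hnbrs : ∀ v u, u ∈ nbrs v → G.Adj v u) {dc : ℕ}
    (hloop : LoopRun w nbrs D good G dc hd d pre) {u : Fin n} (rem : ℕ) :
    ∀ (T : Table n) (r : Reg → ℕ) (m : ℕ → Option ℕ) (lz : ℕ → ℕ) (i : ℕ),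
      T.dc = dc → i + rem = (nbrs u).length → T.tgt c = u → T.lab c = d → T.Done hd c →
      State T G hd d pre r m lz → ScanRegs T c d i (nbrs u).length r →
      (∀ i, T.Done hd i → i ≠ c → T.Closed G i) →
      (∀ p v, p < i → (nbrs u)[p]? = some v →
        ∃ j, T.Valid j ∧ T.src j = T.src c ∧ T.tgt j = v ∧ T.lab j ≤ d + 1) →
      (∀ v, G.Adj u v → v ∈ nbrs u) → (nbrs u).length ≤ n →
      Run w nbrs D good (70 * rem + 101) pre (.scan 0) r m (8 * n + 8 * (dc * n)) lz
        (2 + dc * n) := by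
  induction rem with
  | zero =>
    intro T r m lz i hdc hi hu hlab hc hst hr hcl hp hadj hlen
    refine .ifEq rfl (fun _ => ?_) (fun h => absurd ?_ h)
    · refine (hloop T r m lz hdc hst fun j hj => ?_).mono (by omega)
      by_cases hjc : j = c
      · subst hjc
        intro v hv
        rw [hu] at hv
        obtain ⟨p, hp'⟩ := List.mem_iff_getElem?.1 (hadj v hv)
        rw [hlab]
        refine hp p v ?_ hp'
        have := (List.getElem?_eq_some_iff.1 hp').1
        omega
      · exact hcl j hj hjc
    · rw [hr.i, hr.deg]
      exact hi
  | succ rem ih =>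
    intro T r m lz i hdc hi hu hlab hc hst hr hcl hp hadj hlen
    have hq := hst.queue
    have hcv := hq.valid_of_done hc
    have hin : i < (nbrs u).length := by omega
    obtain ⟨v, hv⟩ : ∃ v, (nbrs u)[i]? = some v := ⟨_, List.getElem?_eq_getElem hin⟩
    have hvn := v.2
    have hf := hst.fits hw
    have hcell : cell (T.src c) v ≤ T.dc * n := cell_lt _ _ (hq.row c hcv)
    have hdcn := Nat.mul_le_mul_right n hq.dc_le
    have hce : cell (T.src c) v = T.src c * n + v + 1 := rfl
    rw [hdc] at hf hcell hdcn
    refine .ifEq rfl (fun h => absurd h (by rw [hr.i, hr.deg]; omega)) (fun _ => ?_)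
    refine .neighbor u v rfl (by rw [hr.u, hu]) (by rw [hr.i, hv]) (by omega) ?_
    refine .add (i + 1) rfl (by simp [hr.i, hst.params.one]) (by omega) ?_
    refine .add (cell (T.src c) v) rfl (by simp [hr.base, hce]; omega) (by omega) ?_
    refine .move (cell (T.src c) v) rfl (by simp) (by omega) ?_
    have hpar : Params T (Function.update (Function.update (Function.update (Function.update r
        .t v) .i (i + 1)) .k (cell (T.src c) v)) .q (cell (T.src c) v)) :=
      ⟨by simp [hst.params.n], by simp [hst.params.one], by simp [hst.params.dc],
        by simp [hst.params.tl]⟩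
    -- Shared by the known and the new case: the invariant for the positions read so far, extended
    -- by position `i`.
    have hp' : ∀ T' : Table n, (∀ s v, (∃ j, T.Valid j ∧ T.src j = s ∧ T.tgt j = v ∧ T.lab j ≤ d + 1) →
          ∃ j, T'.Valid j ∧ T'.src j = s ∧ T'.tgt j = v ∧ T'.lab j ≤ d + 1) →
        T'.src c = T.src c →
        (∃ j, T'.Valid j ∧ T'.src j = T.src c ∧ T'.tgt j = v ∧ T'.lab j ≤ d + 1) →
        ∀ p v, p < i + 1 → (nbrs u)[p]? = some v →
          ∃ j, T'.Valid j ∧ T'.src j = T'.src c ∧ T'.tgt j = v ∧ T'.lab j ≤ d + 1 := by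
      intro T' hT hsc hv' p v'' hpi hp'
      rw [hsc]
      obtain hpi | rfl := Nat.lt_succ_iff_lt_or_eq.1 hpi
      · exact hT _ _ (hp p v'' hpi hp')
      · rw [hv] at hp'
        cases hp'
        exact hv'
    refine Run.mono (k := 70 * rem + 166) (by omega) ?_
    refine .test (q := cell (T.src c) v) hst.stored hf hpar (by simp) (by omega) ?_ ?_
    · rintro j r' hr' - - - hj hjk -
      obtain ⟨hjs, hjt⟩ := cell_injective hjk
      have hf' : ∀ y, y ∉ ([.q, .j, .a, .x, .p, .lp, .rp, .t, .i, .k] : List Reg) → r' y = r y := by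
        intro y hy
        simp only [List.mem_cons, List.not_mem_nil, or_false, not_or] at hy
        rw [hr' y (by simp [hy])]
        simp [hy]
      refine (ih T r' m lz (i + 1) hdc (by omega) hu hlab hc ?_ ?_ hcl ?_ hadj hlen).mono (by omega)
      · exact ⟨hq, hst.stored, hst.emitted, hr'.params hpar, (hf' _ (by decide)).trans hst.zero,
          (hf' _ (by decide)).trans hst.n8, (hf' _ (by decide)).trans hst.hd,
          (hf' _ (by decide)).trans hst.nb⟩
      · exact ⟨(hf' _ (by decide)).trans hr.s, (hf' _ (by decide)).trans hr.u,
          (hf' _ (by decide)).trans hr.d1, (hf' _ (by decide)).trans hr.base,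
          (hf' _ (by decide)).trans hr.deg, by rw [hr' _ (by decide)]; simp⟩
      · refine hp' T (fun s v h => h) rfl ⟨j, hj, hjs, hjt, ?_⟩
        obtain hj | hj := hj
        · rw [(hq.diag j hj).2.2]
          omega
        · exact hq.le_succ j hj.1 hj.2
    · rintro r' hr' - - - hnv
      have hx := Table.push_extends (l := d + 1) hq.dc_le (hq.n_le.trans hq.hd_le) hnv
      have hct : c ≠ T.tl := hx.ne hcv
      have hq' : (T.push (T.src c) v (d + 1)).Queue G hd d :=
        hq.push hcv rfl hlab (hnbrs _ _ (hu ▸ List.mem_of_getElem? hv)) hnv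
      have hadl := hq.add_le
      have hnle := hq.n_le
      have hdle := hq.hd_le
      have hms : 8 * n + 8 * (dc * n) < 2 ^ w := by omega
      have hff : (T.push (T.src c) v (d + 1)).Fits w (8 * n + 8 * (dc * n)) (2 + dc * n) :=
        Table.fits (fun i j hi hj => hx.key_injOn (fun i j => hst.stored.key_injOn) hi hj)
          (hdc ▸ hq'.row) hq'.dc_le hms (by omega)
      have htl := hff.rec_le T.tl ((hx.valid _).2 (.inr rfl))
      refine .move T.tl rfl (by rw [(hr'.params hpar).tl]) (by omega) ?_
      have e1 : (T.push (T.src c) v (d + 1)).src T.tl = T.src c := Function.update_self _ _ _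
      have e2 : (T.push (T.src c) v (d + 1)).tgt T.tl = v := Function.update_self _ _ _
      have e3 : (T.push (T.src c) v (d + 1)).lab T.tl = d + 1 := Function.update_self _ _ _
      have hpar' : Params T (Function.update r' .idx T.tl) := by
        have := hr'.params hpar
        exact ⟨by simp [this.n], by simp [this.one], by simp [this.dc], by simp [this.tl]⟩
      refine Run.mono (k := 70 * rem + 101 + 2 + 45) (by omega) ?_
      refine .mark hst.stored hx hf hff hpar' ⟨?_, ?_, ?_, ?_, ?_⟩ ?_
      · rw [Function.update_of_ne (by decide), hr' _ (by decide)]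
        simp [Table.key, e1, e2]
      · rw [Function.update_of_ne (by decide), hr' _ (by decide), e1]
        simp [hr.s]
      · rw [Function.update_of_ne (by decide), hr' _ (by decide), e2]
        simp
      · rw [Function.update_of_ne (by decide), hr' _ (by decide), e3]
        simp [hr.d1]
      · simp
      intro r'' m' lz' hr'' hst'
      have hpar'' := hr''.params hpar'
      have hidx : r'' .idx = T.tl := by
        rw [hr'' _ (by decide)]
        simp
      refine .ifLt rfl (fun h => ?_) (fun _ => ?_)
      · rw [hidx, hpar''.n] at h
        omega
      refine .add (T.tl + 1) rfl (by rw [hpar''.tl, hpar''.one]) (by omega) ?_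
      have hf' : ∀ y, y ∉ ([.q, .j, .a, .x, .p, .lp, .rp, .t, .i, .k, .idx, .tl] : List Reg) →
          Function.update r'' .tl (T.tl + 1) y = r y := by
        intro y hy
        simp only [List.mem_cons, List.not_mem_nil, or_false, not_or] at hy
        rw [Function.update_of_ne (by simp [hy]), hr'' y (by simp [hy]),
          Function.update_of_ne (by simp [hy]), hr' y (by simp [hy])]
        simp [hy]
      refine ih (T.push (T.src c) v (d + 1)) _ m' lz' (i + 1) hdc (by omega) ?_ ?_ hc ?_ ?_ ?_ ?_
        hadj hlen
      · rw [hx.tgt c hct, hu]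
      · rw [hx.lab c hct, hlab]
      · refine ⟨hq', hst', hst.emitted.extends hx ?_, ⟨?_, ?_, ?_, ?_⟩, ?_, ?_, ?_, ?_⟩
        · exact fun h => hx.new (hq.valid_of_done h)
        · exact (hf' _ (by decide)).trans hst.params.n
        · exact (hf' _ (by decide)).trans hst.params.one
        · exact (hf' _ (by decide)).trans hst.params.dc
        · simp [Table.push]
        · exact (hf' _ (by decide)).trans hst.zero
        · exact (hf' _ (by decide)).trans hst.n8
        · exact (hf' _ (by decide)).trans hst.hd
        · exact (hf' _ (by decide)).trans hst.nb
      · refine ⟨?_, ?_, (hf' _ (by decide)).trans hr.d1, ?_, (hf' _ (by decide)).trans hr.deg, ?_⟩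
        · rw [hx.src c hct]
          exact (hf' _ (by decide)).trans hr.s
        · rw [hx.tgt c hct]
          exact (hf' _ (by decide)).trans hr.u
        · rw [hx.src c hct]
          exact (hf' _ (by decide)).trans hr.base
        · rw [Function.update_of_ne (by decide), hr'' _ (by decide),
            Function.update_of_ne (by decide), hr' _ (by decide)]
          simp
      · exact fun j hj hjc => hx.closed (hx.ne (hq.valid_of_done hj)) (hcl j hj hjc)
      · exact hp' _ (fun s v h => hx.exists_record h) (hx.src c hct)
          ⟨T.tl, (hx.valid _).2 (.inr rfl), e1, e2, e3.le⟩

/-- The word size suffices, `nbrs` represents `G`, and `D` suffices for the scan of each list. -/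
structure Input (w : ℕ) {n : ℕ} (nbrs : Fin n → List (Fin n)) (G : Digraph (Fin n)) (D : ℕ) :
    Prop where
  word : 8 * n + 8 * (n * n) + 100 < 2 ^ w
  mem_iff : ∀ v u, u ∈ nbrs v ↔ G.Adj v u
  length_le : ∀ v, (nbrs v).length ≤ n
  delay : ∀ v, 70 * (nbrs v).length + 104 ≤ D

theorem Run.out {c : ℕ} (hin : Input w nbrs G D) (hc : T.Done hd c)
    (hlab : T.lab c = d) (hst : State T G hd d (pre ++ [T.triple c]) r m lz)
    (hloop : LoopRun w nbrs D good G T.dc hd d (pre ++ [T.triple c]))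
    (hs : r .s = T.src c) (ht : r .t = T.tgt c) (hd1 : r .d1 = d)
    (hbase : r .base = T.src c * n + 1)
    (hcl : ∀ i, T.Done hd i → i ≠ c → T.Closed G i) :
    Run w nbrs D good (k + 2) pre (.out 0) r m (8 * n + 8 * (T.dc * n)) lz (2 + T.dc * n) := by
  have hw := hin.word
  have htn := (T.tgt c).2
  have hlen := hin.length_le (T.tgt c)
  have hlt : d + 1 < 2 ^ w := by
    have h1 := hst.queue.add_le
    have h2 := hst.queue.hd_le
    have h3 := Table.tl_le (fun i j => hst.stored.key_injOn) hst.queue.row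
    have := Nat.mul_le_mul_right n hst.queue.dc_le
    omega
  refine .move (T.tgt c) rfl ht (by omega) ?_
  refine .emit rfl ?_
  have e : ((Function.update r .u (T.tgt c : ℕ) .s, Function.update r .u (T.tgt c : ℕ) .u,
      (Function.update r .u (T.tgt c : ℕ) .d1 : ℕ∞)) : Triple) = T.triple c := by
    simp [Table.triple, hs, hd1, hlab]
  rw [e]
  -- The output has reset the budget to `D`, which pays for three preparatory steps and the scan.
  refine Run.mono (hin.delay (T.tgt c)) ?_
  refine .add (d + 1) rfl (by simp [hd1, hst.params.one]) hlt ?_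
  refine .degree (T.tgt c) rfl (by simp) (by omega) ?_
  refine .const rfl (by omega) ?_
  refine .scan hw (fun v u => (hin.mem_iff v u).1) hloop _ T _ m lz 0 rfl (by simp) rfl hlab hc
    ⟨hst.queue, hst.stored, hst.emitted, ⟨?_, ?_, ?_, ?_⟩, ?_, ?_, ?_, ?_⟩
    ⟨?_, ?_, ?_, ?_, ?_, ?_⟩ hcl (fun p v hp => by omega) (fun v => (hin.mem_iff _ v).2) hlen
  · simp [hst.params.n]
  · simp [hst.params.one]
  · simp [hst.params.dc]
  · simp [hst.params.tl]
  · simp [hst.zero]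
  · simp [hst.n8]
  · simp [hst.hd]
  · simp [hst.nb]
  · simp [hs]
  · simp
  · simp
  · simp [hbase]
  · simp
  · simp

theorem Run.diag (hin : Input w nbrs G D) (hlt : T.dc < n) (hst : State T G hd d pre r m lz)
    (hcl : ∀ i, T.Done hd i → T.Closed G i)
    (hloop : ∀ pre', LoopRun w nbrs D good G (T.dc + 1) hd d pre') :
    Run w nbrs D good (k + 58) pre (.diag 0) r m (8 * n + 8 * (T.dc * n)) lz (2 + T.dc * n) := by
  have hw := hin.word
  have hq := hst.queue
  have hp := hst.params
  have hx := Table.addDiag_extends hlt hq.row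
  have hq' := hq.addDiag hlt
  have hdn : (T.dc + 1) * n ≤ n * n := Nat.mul_le_mul_right n hlt
  have hsucc : (T.dc + 1) * n = T.dc * n + n := Nat.succ_mul _ _
  have hinj : ∀ i j, T.Valid i → T.Valid j → T.key i = T.key j → i = j :=
    fun i j => hst.stored.key_injOn
  have hf : T.Fits w (8 * n + 8 * ((T.dc + 1) * n)) (2 + (T.dc + 1) * n) :=
    Table.fits hinj (fun i hi => (hq.row i hi).trans (Nat.lt_succ_self _)) hq.dc_le (by omega)
      (by omega)
  have hf' : (T.addDiag hlt).Fits w (8 * n + 8 * ((T.dc + 1) * n)) (2 + (T.dc + 1) * n) :=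
    Table.fits (fun i j hi hj => hx.key_injOn hinj hi hj) hq'.row hq'.dc_le (by omega) (by omega)
  have e1 : (T.addDiag hlt).src T.dc = ⟨T.dc, hlt⟩ := Function.update_self _ _ _
  have e2 : (T.addDiag hlt).tgt T.dc = ⟨T.dc, hlt⟩ := Function.update_self _ _ _
  have e3 : (T.addDiag hlt).lab T.dc = 0 := Function.update_self _ _ _
  have hd0 := (hq.start hlt).2
  refine .lazyReserve n rfl hp.n (by omega) ?_
  refine .reserve (8 * n) rfl (by simp [hst.n8]) (by omega) ?_
  refine .move (T.dc * n + 1) rfl (by simp [hst.nb]) (by omega) ?_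
  refine .add ((T.dc + 1) * n + 1) rfl (by simp [hst.nb, hp.n]; omega) (by omega) ?_
  refine .move T.dc rfl (by simp [hp.dc]) (by omega) ?_
  refine .move T.dc rfl (by simp [hp.dc]) (by omega) ?_
  refine .move 0 rfl (by simp [hst.zero]) (by omega) ?_
  refine .add (T.dc * n + T.dc + 1) rfl (by simp; omega) (by omega) ?_
  refine .move T.dc rfl (by simp [hp.dc]) (by omega) ?_
  have ems : 8 * n + 8 * (T.dc * n) + 8 * n = 8 * n + 8 * ((T.dc + 1) * n) := by omega
  have els : 2 + T.dc * n + n = 2 + (T.dc + 1) * n := by omega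
  rw [ems, els]
  refine Run.mono (k := k + 2 + 2 + 45) (by omega) ?_
  refine .mark hst.stored hx hf hf' ⟨?_, ?_, ?_, ?_⟩ ⟨?_, ?_, ?_, ?_, ?_⟩ ?_
  · simp [hp.n]
  · simp [hp.one]
  · simp [hp.dc]
  · simp [hp.tl]
  · simp [Table.key, e1, e2, cell]
  · simp [e1]
  · simp [e2]
  · simp [e3]
  · simp
  intro r' m' lz' hr' hst'
  have hdc' : r' .dc = T.dc := by
    rw [hr' _ (by decide)]
    simp [hp.dc]
  have hn' : r' .n = n := by
    rw [hr' _ (by decide)]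
    simp [hp.n]
  have hone' : r' .one = 1 := by
    rw [hr' _ (by decide)]
    simp [hp.one]
  refine .ifLt rfl (fun _ => ?_) (fun h => ?_)
  swap
  · rw [hr' .idx (by decide), hn'] at h
    simp at h
    omega
  refine .add (T.dc + 1) rfl (by rw [hdc', hone']) (by omega) ?_
  have hem : (T.addDiag hlt).Emitted (Table.Done (T.addDiag hlt) hd) d
      (pre ++ [(T.addDiag hlt).triple T.dc]) := by
    -- Only distances `0` have been emitted so far, so the new label `0` keeps the list sorted.
    have hd' : d = (T.addDiag hlt).lab T.dc := by rw [e3, hd0]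
    have hem' : (T.addDiag hlt).Emitted (Table.Done T hd) d pre :=
      hst.emitted.extends hx fun h => hx.new (hq.valid_of_done h)
    rw [show (T.addDiag hlt).Emitted (Table.Done (T.addDiag hlt) hd) d =
      (T.addDiag hlt).Emitted (Table.Done (T.addDiag hlt) hd) ((T.addDiag hlt).lab T.dc) by rw [← hd']]
    refine hem'.append (fun i => ?_) (fun i hi h => ?_) hd'.le
    · simp only [Table.Done, Table.addDiag]
      omega
    · have hv := hq.valid_of_done hi
      rw [hx.key (hx.ne hv)] at h
      exact hx.notVis ⟨i, hv, h⟩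
  have hdone : (T.addDiag hlt).Done hd T.dc := .inl (Nat.lt_succ_self _)
  refine .out (T := T.addDiag hlt) (c := T.dc) (d := d) hin hdone (by rw [e3, hd0])
    ⟨hq', hst', hem, ⟨?_, ?_, ?_, ?_⟩, ?_, ?_, ?_, ?_⟩ (hloop _) ?_ ?_ ?_ ?_ ?_
  · rw [Function.update_of_ne (by decide), hn']
  · rw [Function.update_of_ne (by decide), hone']
  · rw [Function.update_self]
    rfl
  · rw [Function.update_of_ne (by decide), hr' _ (by decide)]
    simp [hp.tl, Table.addDiag]
  · rw [Function.update_of_ne (by decide), hr' _ (by decide)]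
    simp [hst.zero]
  · rw [Function.update_of_ne (by decide), hr' _ (by decide)]
    simp [hst.n8]
  · rw [Function.update_of_ne (by decide), hr' _ (by decide)]
    simp [hst.hd]
  · rw [Function.update_of_ne (by decide), hr' _ (by decide)]
    simp [Table.addDiag]
  · rw [Function.update_of_ne (by decide), hr' _ (by decide), e1]
    simp
  · rw [Function.update_of_ne (by decide), hr' _ (by decide), e2]
    simp
  · rw [Function.update_of_ne (by decide), hr' _ (by decide)]
    simp [hd0]
  · rw [Function.update_of_ne (by decide), hr' _ (by decide), e1]
    simp
  · intro i hi hne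
    refine hx.closed hne (hcl i ?_)
    simp only [Table.Done, Table.addDiag] at hi ⊢
    omega

theorem Run.pop (hin : Input w nbrs G D) (hdc : T.dc = n) (hlt : hd < T.tl)
    (hst : State T G hd d pre r m lz) (hcl : ∀ i, T.Done hd i → T.Closed G i)
    (hloop : ∀ d' pre', LoopRun w nbrs D good G T.dc (hd + 1) d' pre') :
    Run w nbrs D good (k + 15) pre (.pop 0) r m (8 * n + 8 * (T.dc * n)) lz (2 + T.dc * n) := by
  have hw := hin.word
  have hq := hst.queue
  have hp := hst.params
  have hn := hq.n_le
  have hv : T.Valid hd := .inr ⟨hn, hlt⟩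
  have hf := hst.fits hw
  have h8 := hf.rec_le hd hv
  have hk := hf.key_lt hd hv
  have hmsw := hf.ms_lt
  have hlsw := hf.ls_lt
  have hkey : T.key hd = T.src hd * n + T.tgt hd + 1 := rfl
  have hs := (T.src hd).2
  have ht := (T.tgt hd).2
  have hl := hq.lab_add_le hd hn hlt
  refine .ifEq rfl (fun h => absurd h (by rw [hst.hd, hp.tl]; omega)) (fun _ => ?_)
  refine .add (2 * hd) rfl (by simp [hst.hd]; omega) (by omega) ?_
  refine .add (4 * hd) rfl (by simp; omega) (by omega) ?_
  refine .add (8 * hd) rfl (by simp; omega) (by omega) ?_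
  refine .load (T.key hd) rfl (by simp; omega) (by simpa using hst.stored.key hd hv) (by omega) ?_
  refine .add (8 * hd + 1) rfl (by simp [hp.one]) (by omega) ?_
  refine .load (T.src hd) rfl (by simp; omega) (by simpa using hst.stored.src hd hv) (by omega) ?_
  refine .add (8 * hd + 2) rfl (by simp [hp.one]) (by omega) ?_
  refine .load (T.tgt hd) rfl (by simp; omega) (by simpa using hst.stored.tgt hd hv) (by omega) ?_
  refine .add (8 * hd + 3) rfl (by simp [hp.one]) (by omega) ?_
  refine .load (T.lab hd) rfl (by simp; omega) (by simpa using hst.stored.lab hd hv) (by omega) ?_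
  refine .sub (T.src hd * n + 1) rfl (by simp [hkey]; omega) (by omega) ?_
  refine .add (hd + 1) rfl (by simp [hst.hd, hp.one]) (by omega) ?_
  have hem : T.Emitted (T.Done (hd + 1)) (T.lab hd) (pre ++ [T.triple hd]) := by
    refine hst.emitted.append (fun i => ?_) (fun i hi h => ?_) (hq.le_lab hd le_rfl hlt)
    · simp only [Table.Done]
      omega
    · have h' := hst.stored.key_injOn (hq.valid_of_done hi) hv h
      unfold Table.Done at hi
      omega
  refine .out (T := T) (c := hd) (d := T.lab hd) hin (.inr ⟨hn, Nat.lt_succ_self _⟩) rfl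
    ⟨hq.pop hdc hlt, hst.stored, hem, ⟨?_, ?_, ?_, ?_⟩, ?_, ?_, ?_, ?_⟩ (hloop _ _) ?_ ?_ ?_ ?_ ?_
  · simp [hp.n]
  · simp [hp.one]
  · simp [hp.dc]
  · simp [hp.tl]
  · simp [hst.zero]
  · simp [hst.n8]
  · simp
  · simp [hst.nb]
  · simp
  · simp
  · simp
  · simp
  · intro i hi hne
    refine hcl i ?_
    unfold Table.Done at hi ⊢
    omega

/-- Each round creates a pair `(s, s)` or pops a record. By `Table.tl_le` the queue never extends
beyond `n + n * n`, so the measure decreases. -/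
theorem Run.loop (hin : Input w nbrs G D)
    (hrest : ∀ (T : Table n) (d : ℕ) (pre : List Triple) (r : Reg → ℕ) (m : ℕ → Option ℕ)
      (lz : ℕ → ℕ), T.dc = n → State T G T.tl d pre r m lz → (∀ i, T.Valid i → T.Closed G i) →
      Run w nbrs D good 90 pre (.rest 0) r m (8 * n + 8 * (n * n)) lz (2 + n * n)) (rem : ℕ) :
    ∀ c hd d pre, (n - c) + (n + n * n - hd) ≤ rem → LoopRun w nbrs D good G c hd d pre := by
  induction rem using Nat.strong_induction_on with
  | _ rem ih =>
    intro c hd d pre hrem T r m lz hdc hst hcl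
    subst hdc
    have hq := hst.queue
    have h1 := hq.dc_le
    refine .ifLt rfl (fun h => ?_) (fun h => ?_)
    · rw [hst.params.dc, hst.params.n] at h
      exact (Run.diag (k := 0) hin h hst hcl fun pre' => ih _ (by omega) _ _ _ _ le_rfl).mono
        (by omega)
    · rw [hst.params.dc, hst.params.n] at h
      have hdc : T.dc = n := le_antisymm h1 h
      obtain hlt | heq := hq.hd_le.lt_or_eq
      · have htl := Table.tl_le (fun i j => hst.stored.key_injOn) hq.row
        rw [hdc] at htl
        exact (Run.pop (k := 0) hin hdc hlt hst hcl fun d' pre' =>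
          ih _ (by omega) _ _ _ _ le_rfl).mono (by omega)
      · subst heq
        refine .ifEq rfl (fun _ => ?_) (fun h => absurd (hst.hd.trans hst.params.tl.symm) h)
        rw [hdc]
        exact (hrest T d pre r m lz hdc hst hcl).mono (by omega)

/-! ### The infinite distances -/

variable {κ : ℕ}

/-- The list `pre` consists of all records and of the pairs with keys below `κ` that are not known,
in sorted order. -/
structure Table.RestEmitted (T : Table n) (κ : ℕ) (pre : List Triple) : Prop where
  nodup : pre.Nodup
  mem : ∀ o, o ∈ pre ↔ (∃ i, T.Valid i ∧ o = T.triple i) ∨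
    ∃ s t : Fin n, cell s t < κ ∧ ¬ T.Vis (cell s t) ∧ o = ((s : ℕ), (t : ℕ), ⊤)
  sorted : pre.Pairwise fun o o' => o.2.2 ≤ o'.2.2

namespace Table

theorem Queue.restEmitted (hq : T.Queue G T.tl d) (h : T.Emitted (T.Done T.tl) d pre) :
    T.RestEmitted 1 pre := by
  refine ⟨h.nodup, fun o => (h.mem o).trans ⟨?_, ?_⟩, h.sorted⟩
  · rintro ⟨i, hi, rfl⟩
    exact .inl ⟨i, hq.valid_of_done hi, rfl⟩
  · rintro (⟨i, hi, rfl⟩ | ⟨s, t, h, -⟩)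
    · exact ⟨i, hi, rfl⟩
    · unfold cell at h
      omega

theorem RestEmitted.skip {κ' : ℕ} (h : T.RestEmitted κ pre) (hle : κ ≤ κ')
    (hvis : ∀ x, κ ≤ x → x < κ' → T.Vis x) : T.RestEmitted κ' pre := by
  refine ⟨h.nodup, fun o => (h.mem o).trans (or_congr_right ?_), h.sorted⟩
  refine exists₂_congr fun s t => ?_
  constructor
  · rintro ⟨h1, h2, h3⟩
    exact ⟨by omega, h2, h3⟩
  · rintro ⟨h1, h2, h3⟩
    refine ⟨?_, h2, h3⟩
    by_contra h4
    exact h2 (hvis _ (not_lt.1 h4) h1)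

theorem RestEmitted.append {s t : Fin n} (h : T.RestEmitted (cell s t) pre)
    (hn : ¬ T.Vis (cell s t)) :
    T.RestEmitted (cell s t + 1) (pre ++ [((s : ℕ), (t : ℕ), ⊤)]) := by
  refine ⟨?_, fun o => ?_, ?_⟩
  · rw [List.nodup_append]
    refine ⟨h.nodup, List.nodup_singleton _, fun a ha b hb hab => ?_⟩
    rw [List.mem_singleton] at hb
    subst hab hb
    obtain ⟨i, -, hi⟩ | ⟨s', t', hlt, -, he⟩ := (h.mem _).1 ha
    · simp [triple] at hi
    · simp only [Prod.mk.injEq, and_true] at he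
      rw [Fin.ext he.1, Fin.ext he.2] at hlt
      exact lt_irrefl _ hlt
  · rw [List.mem_append, List.mem_singleton, h.mem]
    constructor
    · rintro ((h | ⟨s', t', h1, h2, h3⟩) | rfl)
      · exact .inl h
      · exact .inr ⟨s', t', by omega, h2, h3⟩
      · exact .inr ⟨s, t, by omega, hn, rfl⟩
    · rintro (h | ⟨s', t', h1, h2, h3⟩)
      · exact .inl (.inl h)
      · obtain h1 | h1 := Nat.lt_succ_iff_lt_or_eq.1 h1
        · exact .inl (.inr ⟨s', t', h1, h2, h3⟩)
        · obtain ⟨rfl, rfl⟩ := cell_injective h1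
          exact .inr h3
  · rw [List.pairwise_append]
    refine ⟨h.sorted, List.pairwise_singleton _ _, fun a _ b hb => ?_⟩
    rw [List.mem_singleton] at hb
    subst hb
    exact le_top

theorem RestEmitted.isSortedAPSD (h : T.RestEmitted (n * n + 1) pre) (hq : T.Queue G hd d)
    (hdc : T.dc = n) (hcl : ∀ i, T.Valid i → T.Closed G i)
    (hinj : ∀ i j, T.Valid i → T.Valid j → T.key i = T.key j → i = j) :
    IsSortedAPSD G pre := by
  refine ⟨h.nodup, fun o => (h.mem o).trans ⟨?_, ?_⟩, h.sorted⟩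
  · rintro (⟨i, hi, rfl⟩ | ⟨s, t, -, hn, rfl⟩)
    · exact ⟨T.src i, T.tgt i, by rw [hq.hopDist_eq hdc hcl hinj hi, triple]⟩
    · exact ⟨s, t, by rw [hq.hopDist_eq_top hdc hcl hn]⟩
  · rintro ⟨s, t, rfl⟩
    by_cases hv : T.Vis (cell s t)
    · obtain ⟨i, hi, hk⟩ := hv
      obtain ⟨rfl, rfl⟩ := cell_injective hk
      exact .inl ⟨i, hi, by rw [hq.hopDist_eq hdc hcl hinj hi, triple]⟩
    · exact .inr ⟨s, t, Nat.lt_succ_of_le (cell_lt s t s.2), hv,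
        by rw [hq.hopDist_eq_top hdc hcl hv]⟩

end Table

/-! ### The sweep over the keys -/

/-- The registers hold the pair with key `κ`, or the end mark. -/
def Cursor (n κ : ℕ) (r : Reg → ℕ) : Prop :=
  r .zero = 0 ∧ r .k = κ ∧ ((r .s = n ∧ κ = n * n + 1) ∨
    ∃ s t : Fin n, r .s = s ∧ r .t = t ∧ κ = cell s t)

theorem Run.advance {s t : Fin n} (hp : Params T r) (hz : r .zero = 0) (hs : r .s = s)
    (ht : r .t = t) (hk : r .k = cell s t) (hw : n * n + n + 2 < 2 ^ w)
    (h : ∀ r', Params T r' → Cursor n (cell s t + 1) r' →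
      Run w nbrs D good k pre (.rest 3) r' m ms lz ls) :
    Run w nbrs D good (k + 5) pre (.rest 14) r m ms lz ls := by
  have hcell := cell_lt s t s.2
  have hsn := s.2
  have htn := t.2
  have hce : cell s t = s * n + t + 1 := rfl
  have hsucc : ((s : ℕ) + 1) * n = s * n + n := Nat.succ_mul _ _
  refine .add (cell s t + 1) rfl (by rw [hk, hp.one]) (by omega) ?_
  refine .add (t + 1) rfl (by simp [ht, hp.one]) (by omega) ?_
  refine .ifEq rfl (fun h' => ?_) (fun h' => ?_)
  · have h' : (t : ℕ) + 1 = n := by simpa [hp.n] using h'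
    refine .move 0 rfl (by simp [hz]) (by omega) ?_
    refine .add (s + 1) rfl (by simp [hs, hp.one]) (by omega) ?_
    refine h _ ⟨by simp [hp.n], by simp [hp.one], by simp [hp.dc], by simp [hp.tl]⟩
      ⟨by simp [hz], by simp, ?_⟩
    obtain hlt | heq := (Nat.succ_le_of_lt hsn).lt_or_eq
    · refine .inr ⟨⟨s + 1, hlt⟩, ⟨0, by omega⟩, by simp, by simp, ?_⟩
      simp only [cell] at hce ⊢
      omega
    · have heq : (s : ℕ) + 1 = n := heq
      refine .inl ⟨by simp [heq], ?_⟩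
      rw [heq] at hsucc
      omega
  · have h' : (t : ℕ) + 1 ≠ n := by simpa [hp.n] using h'
    refine (h _ ⟨by simp [hp.n], by simp [hp.one], by simp [hp.dc], by simp [hp.tl]⟩
      ⟨by simp [hz], by simp, .inr ⟨s, ⟨t + 1, by omega⟩, by simp [hs], by simp, ?_⟩⟩).mono
      (by omega)
    simp only [cell]
    omega

/-- At an unknown key the sweep outputs or halts at once. This serves both for a key met directly
and for the key after a jump. -/
theorem Run.rest_of_not_vis (hs : T.Stored m lz) (hf : T.Fits w ms ls)
    (hw : n * n + n + 2 < 2 ^ w) (hls : n * n + 1 < ls) (hD : 104 ≤ D)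
    (hgood : ∀ pre, T.RestEmitted (n * n + 1) pre → good pre ms ls)
    (hp : Params T r) (hc : Cursor n κ r) (hem : T.RestEmitted κ pre) (hn : ¬ T.Vis κ)
    (ih : κ ≤ n * n → ∀ r' pre', Params T r' → Cursor n (κ + 1) r' → T.RestEmitted (κ + 1) pre' →
      Run w nbrs D good 60 pre' (.rest 3) r' m ms lz ls) :
    Run w nbrs D good (k + 12) pre (.rest 3) r m ms lz ls := by
  obtain ⟨hz, hk, ⟨hsn, hκ⟩ | ⟨s, t, hrs, hrt, rfl⟩⟩ := hc
  · subst hκ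
    exact .ifEq rfl (fun _ => .halt rfl (hgood pre hem)) (fun h => absurd (hsn.trans hp.n.symm) h)
  · have hcell := cell_lt s t s.2
    have hsn := s.2
    refine .ifEq rfl (fun h => absurd h (by rw [hrs, hp.n]; omega)) (fun _ => ?_)
    refine .move (cell s t) rfl hk (by omega) ?_
    have hpar : Params T (Function.update r .q (cell s t)) :=
      ⟨by simp [hp.n], by simp [hp.one], by simp [hp.dc], by simp [hp.tl]⟩
    refine .test (q := cell s t) (k := k + 1) hs hf hpar (by simp) (by omega) ?_ ?_
    · rintro i r' - - - - hi hik -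
      exact absurd ⟨i, hi, hik⟩ hn
    · rintro r' hr' - - - -
      have hf' : ∀ y, y ∉ ([.q, .j, .a, .x, .p, .lp, .rp] : List Reg) → r' y = r y := by
        intro y hy
        rw [hr' y hy]
        simp only [List.mem_cons, List.not_mem_nil, or_false, not_or] at hy
        simp [hy]
      have e1 := (hf' .s (by decide)).trans hrs
      have e2 := (hf' .t (by decide)).trans hrt
      refine .emitInf rfl ?_
      rw [e1, e2]
      refine Run.mono (k := 60 + 5) (by omega) ?_
      exact .advance (hr'.params hpar) ((hf' _ (by decide)).trans hz) e1 e2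
        ((hf' _ (by decide)).trans hk) hw
        fun r'' hp'' hc'' => ih (by omega) r'' _ hp'' hc'' (hem.append hn)

/-- Since `κ - 1` is unknown, a known `κ` is the left end of its interval, so its pointer is valid.
The key after the interval is unknown, so no second jump precedes the next output. The emitted key,
being unknown, restores the hypothesis for its successor. -/
theorem Run.rest (hs : T.Stored m lz) (hf : T.Fits w ms ls)
    (hw : n * n + n + 2 < 2 ^ w) (hls : n * n + 1 < ls) (hD : 104 ≤ D)
    (hgood : ∀ pre, T.RestEmitted (n * n + 1) pre → good pre ms ls) (rem : ℕ) :
    ∀ κ r pre, n * n + 1 - κ ≤ rem → Params T r → Cursor n κ r → T.RestEmitted κ pre →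
      ¬ T.Vis (κ - 1) → Run w nbrs D good 60 pre (.rest 3) r m ms lz ls := by
  induction rem using Nat.strong_induction_on with
  | _ rem ih =>
    intro κ r pre hrem hp hc hem hn
    by_cases hv : T.Vis κ
    swap
    · refine Run.mono (k := 0 + 12) (by omega) ?_
      exact .rest_of_not_vis hs hf hw hls hD hgood hp hc hem hv fun hκ r' pre' hp' hc' hem' =>
        ih _ (by omega) (κ + 1) r' pre' le_rfl hp' hc' hem' (by simpa using hv)
    obtain ⟨hz, hk, ⟨hsn, hκ⟩ | ⟨s, t, hrs, hrt, rfl⟩⟩ := hc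
    · refine .ifEq rfl (fun _ => .halt rfl (hgood pre (hκ ▸ hem)))
        (fun h => absurd (hsn.trans hp.n.symm) h)
    have hcell := cell_lt s t s.2
    have hsn := s.2
    refine .ifEq rfl (fun h => absurd h (by rw [hrs, hp.n]; omega)) (fun _ => ?_)
    refine .move (cell s t) rfl hk (by omega) ?_
    have hpar : Params T (Function.update r .q (cell s t)) :=
      ⟨by simp [hp.n], by simp [hp.one], by simp [hp.dc], by simp [hp.tl]⟩
    refine .test (q := cell s t) (k := 49) hs hf hpar (by simp) (by omega) ?_ ?_
    swap
    · rintro r' - - - - h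
      exact absurd hv h
    rintro i r' hr' - - - hi hik ha
    have hf' : ∀ y, y ∉ ([.q, .j, .a, .x, .p, .lp, .rp] : List Reg) → r' y = r y := by
      intro y hy
      rw [hr' y hy]
      simp only [List.mem_cons, List.not_mem_nil, or_false, not_or] at hy
      simp [hy]
    have hp' := hr'.params hpar
    obtain ⟨j, hj, hm, hle, hvis, hnj⟩ := hs.right i hi (hik ▸ hn)
    have h8 := hf.rec_le i hi
    have h8j := hf.rec_le j hj
    have hkj := hf.key_lt j hj
    have hmsw := hf.ms_lt
    have hlsw := hf.ls_lt
    have hjs := (T.src j).2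
    have hjt := (T.tgt j).2
    refine .const rfl (by omega) ?_
    refine .add (8 * i + 5) rfl (by simp [ha]) (by omega) ?_
    refine .load (8 * j) rfl (by simp; omega) (by simpa using hm) (by omega) ?_
    refine .load (T.key j) rfl (by simp; omega) (by simpa using hs.key j hj) (by omega) ?_
    refine .add (8 * j + 1) rfl (by simp [hp'.one]) (by omega) ?_
    refine .load (T.src j) rfl (by simp; omega) (by simpa using hs.src j hj) (by omega) ?_
    refine .add (8 * j + 2) rfl (by simp [hp'.one]) (by omega) ?_
    refine .load (T.tgt j) rfl (by simp; omega) (by simpa using hs.tgt j hj) (by omega) ?_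
    refine .advance (k := 24 + 12) (T := T) (s := T.src j) (t := T.tgt j) ⟨?_, ?_, ?_, ?_⟩ ?_ ?_ ?_ ?_ hw ?_
    · simp [hp'.n]
    · simp [hp'.one]
    · simp [hp'.dc]
    · simp [hp'.tl]
    · simpa using (hf' .zero (by decide)).trans hz
    · simp
    · simp
    · simp [Table.key]
    intro r'' hp'' hc''
    have hem' : T.RestEmitted (cell (T.src j) (T.tgt j) + 1) pre := by
      refine hem.skip (by rw [← hik]; exact hle.trans (Nat.le_succ _)) fun x h1 h2 => ?_
      exact hvis x (hik ▸ h1) (Nat.lt_succ_iff.1 h2)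
    have hle' : cell s t ≤ cell (T.src j) (T.tgt j) := hik ▸ hle
    exact .rest_of_not_vis hs hf hw hls hD hgood hp'' hc'' hem' hnj fun hκ r' pre' hp' hc' hem' =>
      ih _ (by omega) _ r' pre' le_rfl hp' hc' hem' (by simpa [Table.key] using hnj)

theorem Run.rest_init (hin : Input w nbrs G D) (hn0 : 0 < n) (hdc : T.dc = n)
    (hst : State T G T.tl d pre r m lz) (hcl : ∀ i, T.Valid i → T.Closed G i)
    (hgood : ∀ out, IsSortedAPSD G out → good out (8 * n + 8 * (n * n)) (2 + n * n)) :
    Run w nbrs D good 90 pre (.rest 0) r m (8 * n + 8 * (n * n)) lz (2 + n * n) := by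
  have hw := hin.word
  have hf := hst.fits hw
  rw [hdc] at hf
  have hD : 104 ≤ D := le_trans (by omega) (hin.delay ⟨0, hn0⟩)
  have hp := hst.params
  refine Run.mono (k := 60 + 3) (by omega) ?_
  refine .move 0 rfl hst.zero (by omega) ?_
  refine .move 0 rfl (by simp [hst.zero]) (by omega) ?_
  refine .move 1 rfl (by simp [hp.one]) (by omega) ?_
  -- The sweep starts at the key `1`, whose predecessor `0` is never known.
  refine .rest hst.stored hf (by omega) (by omega) hD
    (fun out hout => hgood out (hout.isSortedAPSD hst.queue hdc hcl fun i j => hst.stored.key_injOn))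
    _ 1 _ _ le_rfl ⟨by simp [hp.n], by simp [hp.one], by simp [hp.dc], by simp [hp.tl]⟩
    ⟨by simp [hst.zero], by simp, .inr ⟨⟨0, hn0⟩, ⟨0, hn0⟩, by simp, by simp, by simp [cell]⟩⟩
    (hst.queue.restEmitted hst.emitted) T.not_vis_zero

/-! ### The whole run -/

/-- The table without records. -/
def Table.empty (hn : 0 < n) : Table n where
  dc := 0
  tl := n
  src _ := ⟨0, hn⟩
  tgt _ := ⟨0, hn⟩
  lab _ := 0

theorem Table.empty_not_valid (hn : 0 < n) (i : ℕ) : ¬ (Table.empty hn).Valid i := by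
  simp only [Valid, empty]
  omega

theorem Run.init (hin : Input w nbrs G D)
    (hgood : 0 < n → ∀ out, IsSortedAPSD G out → good out (8 * n + 8 * (n * n)) (2 + n * n))
    (hzero : n = 0 → good [] 0 0) (lz : ℕ → ℕ) :
    Run w nbrs D good 112 [] (.init 0) (fun _ => 0) (fun _ => none) 0 lz 0 := by
  have hw := hin.word
  refine .numVerts rfl (by omega) ?_
  refine .const rfl (by omega) ?_
  refine .ifEq rfl (fun h => .halt rfl (hzero (by simpa using h))) (fun h => ?_)
  have hn0 : 0 < n := Nat.pos_of_ne_zero (by simpa using h)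
  refine .const rfl (by omega) ?_
  refine .lazyReserve 2 rfl (by simp) (by omega) ?_
  refine .add (2 * n) rfl (by simp; omega) (by omega) ?_
  refine .add (4 * n) rfl (by simp; omega) (by omega) ?_
  refine .add (8 * n) rfl (by simp; omega) (by omega) ?_
  refine .reserve (8 * n) rfl (by simp) (by omega) ?_
  refine .move n rfl (by simp) (by omega) ?_
  refine .move n rfl (by simp) (by omega) ?_
  refine .move 1 rfl (by simp) (by omega) ?_
  have hnv := Table.empty_not_valid hn0
  have hnd : ∀ i, ¬ (Table.empty hn0).Done n i := by
    intro i
    simp only [Table.Done, Table.empty]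
    omega
  have hloop := Run.loop (good := good) hin (fun T d pre r m lz hdc hst hcl =>
    Run.rest_init hin hn0 hdc hst hcl (hgood hn0)) _ 0 n 0 [] le_rfl
  have e1 : 0 + 8 * n = 8 * n + 8 * (0 * n) := by omega
  have e2 : 0 + 2 = 2 + 0 * n := by omega
  rw [e1, e2]
  refine hloop (Table.empty hn0) _ _ _ rfl ⟨?_, ?_, ?_, ⟨?_, ?_, ?_, ?_⟩, ?_, ?_, ?_, ?_⟩
    fun i hi => absurd hi (hnd i)
  · exact ⟨Nat.zero_le _, le_rfl, le_rfl, fun i hi => absurd hi (Nat.not_lt_zero i),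
      fun i hi => absurd hi (hnv i), fun i hi => absurd hi (hnv i), fun _ _ _ _ _ => le_rfl,
      fun _ _ _ => Nat.zero_le _, fun _ _ _ => Nat.zero_le _,
      fun i h h' => absurd (.inr ⟨h, h'⟩) (hnv i), fun _ => ⟨rfl, rfl⟩, by omega⟩
  · exact ⟨fun i hi => absurd hi (hnv i), fun i hi => absurd hi (hnv i),
      fun i hi => absurd hi (hnv i), fun i hi => absurd hi (hnv i), fun i hi => absurd hi (hnv i),
      fun i hi => absurd hi (hnv i), fun i hi => absurd hi (hnv i)⟩
  · refine ⟨List.nodup_nil, fun o => ?_, List.Pairwise.nil, by simp⟩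
    simp [hnd]
  · simp
  · simp
  · simp [Table.empty]
  · simp [Table.empty]
  · simp
  · simp
  · simp
  · simp [Table.empty]

theorem length_eq_ncard {nbrs : Fin n → List (Fin n)} (h : IsAdjList G nbrs) (v : Fin n) :
    (nbrs v).length = Set.ncard {u | G.Adj v u} := by
  have e : {u | G.Adj v u} = ((nbrs v).toFinset : Set (Fin n)) := by
    ext u
    simp [(h v).2 u]
  rw [e, Set.ncard_coe_finset, List.toFinset_card_of_nodup (h v).1]

end APSD

theorem mainTheorem9 :
    ∃ (P : Program) (C : ℕ),
      ∀ (n : ℕ) (G : Digraph (Fin n)) (nbrs : Fin n → List (Fin n)), IsAdjList G nbrs →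
      ∀ w : ℕ, C * (n + 1) ^ 2 ≤ 2 ^ w →
      ∀ junk : ℕ → Fin (2 ^ w),
        ∃ (out : List Triple) (cf : Config P),
          Enumerates P w nbrs (C * max 1 (maxDeg G)) (Config.init P junk) out cf ∧
          IsSortedAPSD G out ∧
          (n ^ 2 ≤ C * cf.lazySize ∧ cf.lazySize ≤ C * n ^ 2) ∧
          (n ^ 2 ≤ C * cf.space ∧ cf.space ≤ C * n ^ 2) := by
  -- The constant is generous: the delay needs `70 * Δ + 104`, the word size `8 * n + 8 * n ^ 2 +
  -- 100`, and the memory for `n > 0` is `9 * n ^ 2 + 8 * n + 2` words in all.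
  refine ⟨APSD.prog, 1000, fun n G nbrs hadj w hw junk => ?_⟩
  have hsq : (n + 1) ^ 2 = n * n + 2 * n + 1 := by ring
  rw [hsq] at hw
  have hin : APSD.Input w nbrs G (1000 * max 1 (maxDeg G)) := by
    refine ⟨by omega, fun v => (hadj v).2, fun v => ?_, fun v => ?_⟩
    · simpa using (hadj v).1.length_le_card
    · have h1 : (nbrs v).length ≤ maxDeg G := by
        rw [APSD.length_eq_ncard hadj v]
        exact Finset.le_sup (f := fun v : Fin n => Set.ncard {u | G.Adj v u}) (Finset.mem_univ v)
      have h2 := le_max_left 1 (maxDeg G)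
      have h3 := le_max_right 1 (maxDeg G)
      omega
  have hrun := APSD.Run.init (good := fun out ms ls => IsSortedAPSD G out ∧
      (n ^ 2 ≤ 1000 * ls ∧ ls ≤ 1000 * n ^ 2) ∧
      (n ^ 2 ≤ 1000 * (ms + ls) ∧ ms + ls ≤ 1000 * n ^ 2)) hin (fun hn out hout => ?_) (fun hn => ?_)
    (fun a => (junk a : ℕ))
  · have h2 := le_max_left 1 (maxDeg G)
    exact (hrun.mono (by omega)).enumerates
  · have h2 : n ^ 2 = n * n := sq n
    have h3 : n ≤ n * n := Nat.le_mul_self n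
    exact ⟨hout, by omega, by omega⟩
  · subst hn
    refine ⟨⟨List.nodup_nil, fun o => ?_, List.Pairwise.nil⟩, by simp, by simp⟩
    simp
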